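/- Let $(V,Y,\mathbf 1,\omega)$ be a vertex operator algebra over $\mathbb C$, $V=\bigoplus_{n\in\mathbb Z}V_n$ its decomposition into $L(0)$-eigenspaces (write $\mathrm{wt}\,a=n$ for $a\in V_n$), and $g$ an automorphism of $V$ of finite order $T$. For $0\le r\le T-1$ put $V^r=\{v\in V\mid gv=e^{2\pi i r/T}v\}$, and let $\delta_r=1$ if $r=0$ and $\delta_r=0$ otherwise. For homogeneous $u\in V^r$ and $v\in V$ set $$u\circ_g v=\mathrm{Res}_z\frac{(1+z)^{\mathrm{wt}\,u-1+\delta_r+r/T}}{z^{1+\delta_r}}Y(u,z)v,\qquad u*_gv=\begin{cases}\mathrm{Res}_z\,\dfrac{(1+z)^{\mathrm{wt}\,u}}{z}\,Y(u,z)v & r=0,\\ 0 & r>0,\end{cases}$$ and extend $*_g$ bilinearly to $V$. Let $O_g(V)$ be the linear span of all $u\circ_g v$, and $A_g(V)=V/O_g(V)$. A weak $g$-twisted $V$-module is a complex vector space $M$ with a linear map $v\mapsto Y_M(v,z)=\sum_{n\in\mathbb Q}v_nz^{-n-1}$, $v_n\in\mathrm{End}\,M$, such that for $0\le r\le T-1$,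 $u\in V^r$, $v\in V$, $w\in M$: $u_n=0$ unless $n\in\frac rT+\mathbb Z$; $v_lw=0$ for $l\gg0$; $Y_M(\mathbf 1,z)=1$; and the twisted Jacobi identity $$z_0^{-1}\delta\!\left(\tfrac{z_1-z_2}{z_0}\right)Y_M(u,z_1)Y_M(v,z_2)-z_0^{-1}\delta\!\left(\tfrac{z_2-z_1}{-z_0}\right)Y_M(v,z_2)Y_M(u,z_1)=z_2^{-1}\left(\tfrac{z_1-z_0}{z_2}\right)^{-r/T}\delta\!\left(\tfrac{z_1-z_0}{z_2}\right)Y_M(Y(u,z_0)v,z_2)$$ holds. Let $\mathcal L(V,g)=\bigoplus_{r=0}^{T-1}t^{r/T}\mathbb C[t,t^{-1}]\otimes V^r$, $D=\frac{d}{dt}\otimes1+1\otimes L(-1)$ and $V[g]=\mathcal L(V,g)/D\mathcal L(V,g)$; write $a(q)$ for the image of $t^q\otimes a$ in $V[g]$, which for homogeneous $a$ has degree $\mathrm{wt}\,a-q-1$. Let $V[g]_-$ be the span of the elements $a(q)$ of negative degree, and for homogeneous $a\in V^0$ put $o(a)=a(\mathrm{wt}\,a-1)$. On a weak $g$-twisted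 $V$-module $M$, $V[g]$ acts by $a(q)\mapsto a_q$. Put $\Omega(M)=\{w\in M\mid V[g]_-w=0\}$. **Theorem.** The product $*_g$ induces on $A_g(V)$ the structure of an associative algebra with unit $\mathbf 1+O_g(V)$, and for every weak $g$-twisted $V$-module $M$ there is a representation of this algebra on $\Omega(M)$ (unit acting as the identity) in which, for each homogeneous $a\in V^0$, the class $a+O_g(V)$ acts as $o(a)$. -/

import Mathlib

open scoped VertexOperator

noncomputable section

/-- A vertex operator algebra structure on the complex vector space `V`: the vertex operator map
`Y(u, z) = ∑ u_n z^{-n-1}` (where `u_n` is written `(Y u)[[n]]`), the vacuum `𝟏` and the Virasoro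
(conformal) vector `ω`. The truncation condition `u_n v = 0` for `n ≫ 0` is part of the type
`VertexOperator ℂ V`. With `L(n) = ω_{n+1}`, the homogeneous subspace `V_n` of weight `n` is the
eigenspace of `L(0)` for the eigenvalue `n`. -/
structure VertexOperatorAlgebra (V : Type*) [AddCommGroup V] [Module ℂ V] where
  /-- the vertex operator map -/
  Y : V →ₗ[ℂ] VertexOperator ℂ V
  /-- the vacuum vector -/
  vac : V
  /-- the conformal vector -/
  omega : V
  /-- the rank (central charge) -/
  rank : ℂ
  /-- `Y(𝟏, z) = id` -/
  vac_mode : ∀ n : ℤ, (Y vac)[[n]] = if n = -1 then 1 else 0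
  /-- `Y(u, z)𝟏` is a power series in `z` ... -/
  mode_vac_of_nonneg : ∀ (u : V) (n : ℤ), 0 ≤ n → ((Y u)[[n]]) vac = 0
  /-- ... with constant term `u` -/
  mode_vac : ∀ u : V, ((Y u)[[-1]]) vac = u
  /-- the Jacobi identity: the coefficient of `z₀^{-l-1} z₁^{-m-1} z₂^{-n-1}` in
  `z₀⁻¹ δ((z₁ - z₂)/z₀) Y(u,z₁) Y(v,z₂) w - z₀⁻¹ δ((z₂ - z₁)/(-z₀)) Y(v,z₂) Y(u,z₁) w
    = z₂⁻¹ δ((z₁ - z₀)/z₂) Y(Y(u,z₀)v,z₂) w`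
  (all three sums are finite, by truncation) -/
  jacobi : ∀ (u v w : V) (l m n : ℤ),
    (∑ᶠ i : ℕ, ((-1 : ℂ) ^ i * Ring.choose (l : ℂ) i) •
        ((Y u)[[m + l - i]]) (((Y v)[[n + i]]) w))
      - (∑ᶠ i : ℕ, ((-1 : ℂ) ^ l * (-1 : ℂ) ^ i * Ring.choose (l : ℂ) i) •
        ((Y v)[[n + l - i]]) (((Y u)[[m + i]]) w))
    = ∑ᶠ i : ℕ, Ring.choose (m : ℂ) i • ((Y (((Y u)[[l + i]]) v))[[m + n - i]]) w
  /-- the Virasoro relations for `L(n) = ω_{n+1}` -/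
  virasoro : ∀ m n : ℤ,
    (Y omega)[[m + 1]] * (Y omega)[[n + 1]] - (Y omega)[[n + 1]] * (Y omega)[[m + 1]]
      = ((m : ℂ) - n) • (Y omega)[[m + n + 1]]
        + (if m + n = 0 then ((m : ℂ) ^ 3 - m) / 12 * rank else 0) • (1 : Module.End ℂ V)
  /-- `d/dz Y(u, z) = Y(L(-1)u, z)` -/
  derivative : ∀ (u : V) (n : ℤ), (Y (((Y omega)[[0]]) u))[[n]] = (-(n : ℂ)) • (Y u)[[n - 1]]
  /-- `V` is the direct sum of the spaces `V_n`, `n ∈ ℤ` -/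
  isInternal : DirectSum.IsInternal
    (fun n : ℤ => Module.End.eigenspace ((Y omega)[[1]]) (n : ℂ))
  /-- each `V_n` is finite dimensional -/
  finiteDimensional : ∀ n : ℤ,
    FiniteDimensional ℂ (Module.End.eigenspace ((Y omega)[[1]]) (n : ℂ))
  /-- `V_n = 0` for `n` sufficiently small -/
  bounded_below : ∃ N : ℤ, ∀ n < N, Module.End.eigenspace ((Y omega)[[1]]) (n : ℂ) = ⊥

namespace VertexOperatorAlgebra

variable {V : Type*} [AddCommGroup V] [Module ℂ V]

/-- The mode `u_n`, an endomorphism of `V`. -/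
def mode (A : VertexOperatorAlgebra V) (u : V) (n : ℤ) : Module.End ℂ V := (A.Y u)[[n]]

/-- The space `V_n` of homogeneous vectors of weight `n`. -/
def weightSpace (A : VertexOperatorAlgebra V) (n : ℤ) : Submodule ℂ V :=
  Module.End.eigenspace (A.mode A.omega 1) (n : ℂ)

theorem bijective_coeLinearMap (A : VertexOperatorAlgebra V) :
    Function.Bijective (DirectSum.coeLinearMap fun k => A.weightSpace k) := A.isInternal

/-- The projection of `V = ⨁ V_n` onto `V_n`. -/
def weightProj (A : VertexOperatorAlgebra V) (n : ℤ) : V →ₗ[ℂ] V :=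
  (A.weightSpace n).subtype ∘ₗ DirectSum.component ℂ ℤ (fun k => A.weightSpace k) n ∘ₗ
    (LinearEquiv.ofBijective (DirectSum.coeLinearMap fun k => A.weightSpace k)
      A.bijective_coeLinearMap).symm.toLinearMap

/-- `g` is an automorphism of the vertex operator algebra. -/
structure IsAutomorphism (A : VertexOperatorAlgebra V) (g : V ≃ₗ[ℂ] V) : Prop where
  map_mode : ∀ (u v : V) (n : ℤ), g (A.mode u n v) = A.mode (g u) n (g v)
  map_vac : g A.vac = A.vac
  map_omega : g A.omega = A.omega

end VertexOperatorAlgebra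

section Twisted

variable {V : Type*} [AddCommGroup V] [Module ℂ V]

/-- `V^r = {v | g v = e^{2πir/T} v}`, where `T` is the order of `g`. -/
def gEigen (g : V ≃ₗ[ℂ] V) (r : ℕ) : Submodule ℂ V :=
  Module.End.eigenspace g.toLinearMap
    (Complex.exp (2 * Real.pi * Complex.I * r / (orderOf g : ℂ)))

/-- The projection of `V = ⨁ V^r` onto `V^0`, for `g` of finite order `T`:
the average of `1, g, …, g^{T-1}`. -/
def invariantProj (g : V ≃ₗ[ℂ] V) : V →ₗ[ℂ] V :=
  (orderOf g : ℂ)⁻¹ • ∑ k ∈ Finset.range (orderOf g), (g ^ k).toLinearMap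

namespace VertexOperatorAlgebra

/-- For `u ∈ V^r` of weight `n`,
`u ∘_g v = Res_z (1+z)^{n-1+δ_r+r/T} z^{-1-δ_r} Y(u,z)v`, where `δ_r` is `1` if `r = 0` and
`0` otherwise. -/
def circ (A : VertexOperatorAlgebra V) (g : V ≃ₗ[ℂ] V) (n : ℤ) (r : ℕ) (u v : V) : V :=
  ∑ᶠ i : ℕ,
    Ring.choose ((n : ℂ) - 1 + (if r = 0 then 1 else 0) + (r : ℂ) / (orderOf g : ℂ)) i •
      A.mode u ((i : ℤ) - 1 - (if r = 0 then 1 else 0)) v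

/-- `O_g(V)`, the span of all `u ∘_g v` with `u ∈ V^r` homogeneous, `0 ≤ r < T`, and `v ∈ V`. -/
def Og (A : VertexOperatorAlgebra V) (g : V ≃ₗ[ℂ] V) : Submodule ℂ V :=
  Submodule.span ℂ {x | ∃ (n : ℤ) (r : ℕ) (u v : V), r < orderOf g ∧
    u ∈ A.weightSpace n ∧ u ∈ gEigen g r ∧ x = A.circ g n r u v}

/-- The quotient space `A_g(V) = V / O_g(V)`. -/
abbrev Ag (A : VertexOperatorAlgebra V) (g : V ≃ₗ[ℂ] V) := V ⧸ A.Og g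

/-- The bilinear product `*_g` on `V`: for `u` of weight `n` in `V^0`,
`u *_g v = Res_z (1+z)^n z⁻¹ Y(u,z)v`, while `u *_g v = 0` for `u ∈ V^r`, `0 < r < T`. For general
`u` it is applied to the components of `u` in `V_n ∩ V^0`, `n ∈ ℤ`. -/
def starProduct (A : VertexOperatorAlgebra V) (g : V ≃ₗ[ℂ] V) (u v : V) : V :=
  ∑ᶠ n : ℤ, ∑ᶠ i : ℕ,
    Ring.choose (n : ℂ) i • A.mode (A.weightProj n (invariantProj g u)) ((i : ℤ) - 1) v

/-- `𝓛(V, g) = ⨁_{0 ≤ r < T} t^{r/T} ℂ[t, t⁻¹] ⊗ V^r`, realised inside the space `ℚ →₀ V` of finite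
sums of `t^q ⊗ a`, where `t^q ⊗ a` is `Finsupp.single q a`. -/
def loopSpace (_A : VertexOperatorAlgebra V) (g : V ≃ₗ[ℂ] V) : Submodule ℂ (ℚ →₀ V) :=
  Submodule.span ℂ {x | ∃ (r : ℕ) (k : ℤ) (a : V), r < orderOf g ∧ a ∈ gEigen g r ∧
    x = Finsupp.single ((r : ℚ) / (orderOf g : ℚ) + k) a}

/-- The operator `D = d/dt ⊗ 1 + 1 ⊗ L(-1)`. -/
def loopD (A : VertexOperatorAlgebra V) : (ℚ →₀ V) →ₗ[ℂ] (ℚ →₀ V) :=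
  Finsupp.lsum ℂ fun q : ℚ =>
    (q : ℂ) • Finsupp.lsingle (q - 1) + Finsupp.lsingle q ∘ₗ A.mode A.omega 0

/-- The space `V[g] = 𝓛(V, g) / D 𝓛(V, g)` underlying the Lie algebra `V[g]`. -/
abbrev Vg (A : VertexOperatorAlgebra V) (g : V ≃ₗ[ℂ] V) :=
  A.loopSpace g ⧸ ((A.loopSpace g).map A.loopD).comap (A.loopSpace g).subtype

/-- `V[g]_-`, spanned by the images `a(q)` of those `t^q ⊗ a ∈ 𝓛(V, g)`, with `a ∈ V^r` homogeneous
and `q ∈ r/T + ℤ`, whose degree `wt a - q - 1` is negative. -/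
def VgNeg (A : VertexOperatorAlgebra V) (g : V ≃ₗ[ℂ] V) : Submodule ℂ (A.Vg g) :=
  Submodule.span ℂ {x | ∃ (n : ℤ) (r : ℕ) (k : ℤ) (a : V) (hr : r < orderOf g)
    (ha : a ∈ gEigen g r), a ∈ A.weightSpace n ∧
    (n : ℚ) - ((r : ℚ) / (orderOf g : ℚ) + k) - 1 < 0 ∧
    x = Submodule.Quotient.mk ⟨Finsupp.single ((r : ℚ) / (orderOf g : ℚ) + k) a,
      Submodule.subset_span ⟨r, k, a, hr, ha, rfl⟩⟩}

theorem single_mem_loopSpace_of_invariant (A : VertexOperatorAlgebra V) {g : V ≃ₗ[ℂ] V}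
    (hg : IsOfFinOrder g) {a : V} (ha : a ∈ gEigen g 0) (k : ℤ) :
    Finsupp.single (k : ℚ) a ∈ A.loopSpace g :=
  Submodule.subset_span ⟨0, k, a, hg.orderOf_pos, ha, by simp⟩

/-- `o(a) = a(wt a - 1) ∈ V[g]`, for `a ∈ V^0` of weight `n`. -/
def o (A : VertexOperatorAlgebra V) {g : V ≃ₗ[ℂ] V} (hg : IsOfFinOrder g) (n : ℤ) (a : V)
    (ha : a ∈ gEigen g 0) : A.Vg g :=
  Submodule.Quotient.mk
    ⟨Finsupp.single ((n - 1 : ℤ) : ℚ) a, A.single_mem_loopSpace_of_invariant hg ha (n - 1)⟩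

/-- `L(-1)a = a_{-2}𝟏`. -/
theorem L_neg_one_eq (A : VertexOperatorAlgebra V) (a : V) :
    A.mode A.omega 0 a = A.mode a (-2) A.vac := by
  have h := LinearMap.congr_fun (A.derivative a (-1)) A.vac
  rw [A.mode_vac] at h
  simpa [mode] using h

end VertexOperatorAlgebra

/-- A weak `g`-twisted `V`-module structure on the complex vector space `M`:
`Y_M(v, z) = ∑_{n ∈ ℚ} v_n z^{-n-1}`, where `v_n` is `mode v n`. -/
structure WeakTwistedModule (A : VertexOperatorAlgebra V) (g : V ≃ₗ[ℂ] V)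
    (M : Type*) [AddCommGroup M] [Module ℂ M] where
  /-- the modes of the vertex operators on `M` -/
  mode : V →ₗ[ℂ] (ℚ → Module.End ℂ M)
  /-- for `u ∈ V^r`, only the `u_n` with `n ∈ r/T + ℤ` occur -/
  mode_eq_zero : ∀ r : ℕ, r < orderOf g → ∀ u ∈ gEigen g r, ∀ n : ℚ,
    (∀ k : ℤ, n ≠ (r : ℚ) / (orderOf g : ℚ) + k) → mode u n = 0
  /-- `v_l w = 0` for `l ≫ 0` -/
  truncation : ∀ (v : V) (w : M), ∃ N : ℚ, ∀ l : ℚ, N ≤ l → mode v l w = 0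
  /-- `Y_M(𝟏, z) = id` -/
  vac_mode : ∀ n : ℚ, mode A.vac n = if n = -1 then 1 else 0
  /-- the twisted Jacobi identity, for `u ∈ V^r`: the coefficient of
  `z₀^{-l-1} z₁^{-m-1} z₂^{-n-1}` in
  `z₀⁻¹ δ((z₁ - z₂)/z₀) Y_M(u,z₁) Y_M(v,z₂) w - z₀⁻¹ δ((z₂ - z₁)/(-z₀)) Y_M(v,z₂) Y_M(u,z₁) w
    = z₂⁻¹ ((z₁ - z₀)/z₂)^{-r/T} δ((z₁ - z₀)/z₂) Y_M(Y(u,z₀)v,z₂) w`,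
  where `l ∈ ℤ`, `m = r/T + k` with `k ∈ ℤ`, and `n ∈ ℚ`
  (for `m ∉ r/T + ℤ` the coefficients on both sides vanish) -/
  jacobi : ∀ r : ℕ, r < orderOf g → ∀ u ∈ gEigen g r, ∀ (v : V) (w : M) (l k : ℤ) (m n : ℚ),
    m = (r : ℚ) / (orderOf g : ℚ) + k →
    (∑ᶠ i : ℕ, ((-1 : ℂ) ^ i * Ring.choose (l : ℂ) i) • mode u (m + l - i) (mode v (n + i) w))
      - (∑ᶠ i : ℕ, ((-1 : ℂ) ^ l * (-1 : ℂ) ^ i * Ring.choose (l : ℂ) i) •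
        mode v (n + l - i) (mode u (m + i) w))
    = ∑ᶠ i : ℕ, Ring.choose (m : ℂ) i • mode (A.mode u (l + i) v) (m + n - i) w

namespace WeakTwistedModule

variable {A : VertexOperatorAlgebra V} {g : V ≃ₗ[ℂ] V} {M : Type*} [AddCommGroup M] [Module ℂ M]

/-- The map `t^q ⊗ a ↦ a_q`. -/
def loopAction (W : WeakTwistedModule A g M) : (ℚ →₀ V) →ₗ[ℂ] Module.End ℂ M :=
  Finsupp.lsum ℂ fun q : ℚ => LinearMap.proj q ∘ₗ W.mode

/-- `(L(-1)a)_q = -q a_{q-1}` for `a ∈ V^r` and `q ∈ r/T + ℤ`. -/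
theorem mode_L_neg_one (W : WeakTwistedModule A g M) {r : ℕ} (hr : r < orderOf g) {a : V}
    (ha : a ∈ gEigen g r) (k : ℤ) {q : ℚ} (hq : q = (r : ℚ) / (orderOf g : ℚ) + k) :
    (q : ℂ) • W.mode a (q - 1) + W.mode (A.mode A.omega 0 a) q = 0 := by
  ext w
  have h := W.jacobi r hr a ha A.vac w (-2) k q 0 hq
  have h1 : ∀ i : ℕ, W.mode A.vac (0 + i) = 0 := fun i => by
    rw [W.vac_mode, if_neg]
    have : (0 : ℚ) ≤ i := Nat.cast_nonneg i
    intro h; linarith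
  have h2 : ∀ i : ℕ, W.mode A.vac (0 + ((-2 : ℤ) : ℚ) - i) = 0 := fun i => by
    rw [W.vac_mode, if_neg]
    have : (0 : ℚ) ≤ i := Nat.cast_nonneg i
    push_cast
    intro h; linarith
  simp only [h1, h2, LinearMap.zero_apply, map_zero, smul_zero, finsum_zero, sub_zero] at h
  rw [finsum_eq_sum_of_support_subset (s := Finset.range 2)] at h
  · have h3 : A.mode a (-1) A.vac = a := A.mode_vac a
    rw [A.L_neg_one_eq]
    simp [Finset.sum_range_succ, h3] at h
    simp [add_comm, ← h]
  · intro i hi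
    by_contra hi'
    have hi2 : 2 ≤ i := by simpa [Nat.lt_iff_add_one_le] using hi'
    have : A.mode a (-2 + i) A.vac = 0 := A.mode_vac_of_nonneg a _ (by omega)
    simp [this] at hi

theorem loopAction_single (W : WeakTwistedModule A g M) (q : ℚ) (a : V) :
    W.loopAction (Finsupp.single q a) = W.mode a q := by
  rw [loopAction, Finsupp.lsum_single]
  rfl

theorem loopAction_loopD (W : WeakTwistedModule A g M) {x : ℚ →₀ V} (hx : x ∈ A.loopSpace g) :
    W.loopAction (A.loopD x) = 0 := by
  induction hx using Submodule.span_induction with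
  | mem x h =>
    obtain ⟨r, k, a, hr, ha, rfl⟩ := h
    have := W.mode_L_neg_one hr ha k rfl
    rw [VertexOperatorAlgebra.loopD, Finsupp.lsum_single]
    simpa only [LinearMap.add_apply, LinearMap.smul_apply, LinearMap.comp_apply,
      Finsupp.lsingle_apply, map_add, map_smul, loopAction_single] using this
  | zero => simp
  | add x y _ _ hx hy => simp [hx, hy]
  | smul c x _ hx => simp [hx]

/-- The action of `V[g]` on `M`, in which `a(q)` acts as `a_q`. -/
def action (W : WeakTwistedModule A g M) : A.Vg g →ₗ[ℂ] Module.End ℂ M :=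
  Submodule.liftQ _ (W.loopAction ∘ₗ (A.loopSpace g).subtype) <| by
    rintro ⟨x, hx⟩ ⟨y, hy, hxy⟩
    have : A.loopD y = x := hxy
    simp [← this, W.loopAction_loopD hy]

/-- `Ω(M) = {w ∈ M | V[g]_- w = 0}`. -/
def Omega (W : WeakTwistedModule A g M) : Submodule ℂ M where
  carrier := {w | ∀ x ∈ A.VgNeg g, W.action x w = 0}
  zero_mem' := by simp
  add_mem' := fun h₁ h₂ x hx => by simp [h₁ x hx, h₂ x hx]
  smul_mem' := fun c w h x hx => by simp [h x hx]

end WeakTwistedModule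

end Twisted

end

/-!
For `u ∈ V^0`, left multiplication by `u` is `Res_z (1 + z)^{wt u} z⁻¹ Y(u, z)`. Skew-symmetry
`Y(u, z)v = e^{zL(-1)} Y(v, -z)u` and the congruence `L(-1)u ≡ -(wt u) u` modulo `O_g(V)` show
that, modulo `O_g(V)`, right multiplication by `v ∈ V^0` is `Res_z (1 + z)^{wt v - 1} z⁻¹ Y(v, z)`.
By the commutator formula both operators preserve `O_g(V)`, and a left and a right multiplication
commute modulo `O_g(V)`, which is associativity.

On `Ω(M)`, `V` acts by zero modes. In the coefficients of the twisted Jacobi identity whose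
right-hand side consists of zero modes, the second term on the left kills `Ω(M)`. For `u ∘_g v` so
does the first term, and for `u *_g v` just `o(u)o(v)` survives.
-/

noncomputable section

section LaurentSeries

open HahnSeries LaurentSeries

variable (R E : Type*) [CommRing R] [AddCommGroup E] [Module R E]

/-- The linear maps on Laurent series that are continuous for the `X`-adic topology on `R⸨X⸩` and
the discrete topology on the target, i.e. that kill all series of sufficiently large order. -/
def xAdicContinuousMaps : Submodule R (R⸨X⸩ →ₗ[R] E) where
  carrier := {Φ | ∃ N : ℤ, ∀ f : R⸨X⸩, N ≤ f.orderTop → Φ f = 0}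
  zero_mem' := ⟨0, fun _ _ => rfl⟩
  add_mem' := by
    rintro Φ Ψ ⟨N, hN⟩ ⟨N', hN'⟩
    refine ⟨max N N', fun f hf => ?_⟩
    rw [WithTop.coe_max, max_le_iff] at hf
    rw [LinearMap.add_apply, hN f hf.1, hN' f hf.2, add_zero]
  smul_mem' := by
    rintro c Φ ⟨N, hN⟩
    exact ⟨N, fun f hf => by rw [LinearMap.smul_apply, hN f hf, smul_zero]⟩

variable {R E} {Φ Ψ : R⸨X⸩ →ₗ[R] E}

/-- Multiplication by a Laurent series, as a linear map over the coefficient ring. -/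
def mulLaurent (h : R⸨X⸩) : R⸨X⸩ →ₗ[R] R⸨X⸩ where
  toFun f := f * h
  map_add' f f' := add_mul f f' h
  map_smul' c f := by simp only [← single_zero_mul_eq_smul, mul_assoc, RingHom.id_apply]

theorem mulLaurent_apply (f h : R⸨X⸩) : mulLaurent h f = f * h := rfl

theorem comp_hasseDeriv_mem_xAdicContinuousMaps (hΦ : Φ ∈ xAdicContinuousMaps R E) (k : ℕ) :
    Φ ∘ₗ hasseDeriv R k ∈ xAdicContinuousMaps R E := by
  obtain ⟨N, hN⟩ := hΦ
  refine ⟨N + k, fun f hf => hN _ (le_orderTop_iff_forall.2 fun i hi => ?_)⟩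
  have hik : ((i + k : ℤ) : WithTop ℤ) < f.orderTop :=
    (WithTop.coe_lt_coe.2 (by have := WithTop.coe_lt_coe.1 hi; lia)).trans_le hf
  rw [hasseDeriv_coeff, coeff_eq_zero_of_lt_orderTop hik, smul_zero]

theorem comp_mulLaurent_mem_xAdicContinuousMaps (hΦ : Φ ∈ xAdicContinuousMaps R E) (h : R⸨X⸩) :
    Φ ∘ₗ mulLaurent h ∈ xAdicContinuousMaps R E := by
  obtain ⟨N, hN⟩ := hΦ
  refine ⟨N - h.order, fun f hf => hN _ ?_⟩
  rcases eq_or_ne h 0 with rfl | hh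
  · simp [mulLaurent_apply]
  · calc (N : WithTop ℤ) = ((N - h.order : ℤ) : WithTop ℤ) + h.order := by
          rw [← WithTop.coe_add, sub_add_cancel]
      _ ≤ f.orderTop + h.orderTop := by
          rw [order_eq_orderTop_of_ne_zero hh]
          gcongr
      _ ≤ (f * h).orderTop := orderTop_add_le_mul

theorem comp_mem_xAdicContinuousMaps {F : Type*} [AddCommGroup F] [Module R F] (φ : E →ₗ[R] F)
    (hΦ : Φ ∈ xAdicContinuousMaps R E) : φ ∘ₗ Φ ∈ xAdicContinuousMaps R F := by
  obtain ⟨N, hN⟩ := hΦ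
  exact ⟨N, fun f hf => by rw [LinearMap.comp_apply, hN f hf, map_zero]⟩

theorem single_eq_smul_single_one (n : ℤ) (c : R) :
    (single n c : R⸨X⸩) = c • (single n 1 : R⸨X⸩) := by
  rw [← single_zero_mul_eq_smul, single_mul_single, zero_add, mul_one]

theorem map_eq_finsum_of_mem_xAdicContinuousMaps (hΦ : Φ ∈ xAdicContinuousMaps R E) (f : R⸨X⸩) :
    Φ f = ∑ᶠ i : ℤ, f.coeff i • Φ (single i 1) := by
  obtain ⟨N, hN⟩ := hΦ
  rw [finsum_eq_sum_of_support_subset (s := Finset.Ico f.order N)]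
  · set p := ∑ i ∈ Finset.Ico f.order N, single i (f.coeff i) with hp
    have hfp : Φ (f - p) = 0 := by
      refine hN _ (le_orderTop_iff_forall.2 fun i hi => ?_)
      rw [coeff_sub, hp, coeff_sum]
      by_cases hif : f.order ≤ i
      · rw [Finset.sum_eq_single_of_mem i (Finset.mem_Ico.2 ⟨hif, WithTop.coe_lt_coe.1 hi⟩)
          fun j _ hj => coeff_single_of_ne hj.symm, coeff_single_same, sub_self]
      · rw [Finset.sum_eq_zero fun j hj => coeff_single_of_ne fun h : i = j =>
          hif (h ▸ (Finset.mem_Ico.1 hj).1), coeff_eq_zero_of_lt_order (not_le.1 hif), sub_zero]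
    rw [map_sub, sub_eq_zero] at hfp
    rw [hfp, hp, map_sum]
    exact Finset.sum_congr rfl fun i _ => by rw [single_eq_smul_single_one, map_smul]
  · intro i hi
    rw [Finset.coe_Ico, Set.mem_Ico]
    contrapose! hi
    rw [Function.notMem_support]
    by_cases hif : f.order ≤ i
    · rw [hN _ (le_trans (mod_cast hi hif) (orderTop_single_le)), smul_zero]
    · rw [coeff_eq_zero_of_lt_order (not_le.1 hif), zero_smul]

theorem eq_of_mem_xAdicContinuousMaps (hΦ : Φ ∈ xAdicContinuousMaps R E)
    (hΨ : Ψ ∈ xAdicContinuousMaps R E) (h : ∀ n, Φ (single n 1) = Ψ (single n 1)) : Φ = Ψ := by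
  ext f
  rw [map_eq_finsum_of_mem_xAdicContinuousMaps hΦ, map_eq_finsum_of_mem_xAdicContinuousMaps hΨ]
  exact finsum_congr fun i => by rw [h]

theorem hasseDeriv_single_mul (q : ℤ) (f : R⸨X⸩) (k : ℕ) :
    hasseDeriv R k (single q 1 * f) = ∑ ab ∈ Finset.HasAntidiagonal.antidiagonal k,
      Ring.choose q ab.1 • (single (q - ab.1) 1 * hasseDeriv R ab.2 f) := by
  refine HahnSeries.ext (funext fun n => ?_)
  rw [hasseDeriv_coeff, coeff_sum, coeff_single_mul, one_mul, ← add_sub_cancel q (n + k),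
    Ring.add_choose_eq k (Commute.all _ _), Finset.sum_smul]
  refine Finset.sum_congr rfl fun ab hab => ?_
  have hk : (ab.1 : ℤ) + ab.2 = k := mod_cast Finset.HasAntidiagonal.mem_antidiagonal.1 hab
  have hn : n - (q - ab.1) + ab.2 = n + k - q := by lia
  rw [coeff_smul, coeff_single_mul, one_mul, hasseDeriv_coeff, add_sub_cancel_left, hn, mul_smul]

variable [BinomialRing R]

/-- The expansion of `X ^ q * (1 + X) ^ P` in powers of `X`. -/
def binomialLaurent (q : ℤ) (P : R) : R⸨X⸩ :=
  single q 1 * ((PowerSeries.binomialSeries R P : PowerSeries R) : R⸨X⸩)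

theorem coeff_binomialLaurent (q : ℤ) (P : R) (i : ℕ) :
    (binomialLaurent q P).coeff (i + q) = Ring.choose P i := by
  rw [binomialLaurent, coeff_single_mul, add_sub_cancel_right, one_mul,
    LaurentSeries.coeff_coe_powerSeries, PowerSeries.binomialSeries_coeff, smul_eq_mul, mul_one]

theorem coeff_binomialLaurent_of_lt {q n : ℤ} (h : n < q) (P : R) :
    (binomialLaurent q P).coeff n = 0 := by
  rw [binomialLaurent, coeff_single_mul, one_mul, PowerSeries.coeff_coe, if_pos (by lia)]

theorem binomialLaurent_mul (q q' : ℤ) (P P' : R) :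
    binomialLaurent q P * binomialLaurent q' P' = binomialLaurent (q + q') (P + P') := by
  simp only [binomialLaurent, PowerSeries.binomialSeries_add]
  rw [mul_mul_mul_comm, single_mul_single, mul_one, PowerSeries.coe_mul]

theorem binomialLaurent_add_one (q : ℤ) (P : R) :
    binomialLaurent q (P + 1) = binomialLaurent q P + binomialLaurent (q + 1) P := by
  have h1 : PowerSeries.binomialSeries R (1 : R) = 1 + PowerSeries.X := by
    simpa using PowerSeries.binomialSeries_nat (R := R) (A := R) 1
  have h2 : (single q 1 : R⸨X⸩) * single 1 1 = single (q + 1) 1 := by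
    rw [single_mul_single, mul_one]
  simp only [binomialLaurent, PowerSeries.binomialSeries_add, h1, ← h2, PowerSeries.coe_mul,
    PowerSeries.coe_add, PowerSeries.coe_one, PowerSeries.coe_X]
  ring

theorem hasseDeriv_binomialLaurent_zero (P : R) (k : ℕ) :
    hasseDeriv R k (binomialLaurent 0 P) = Ring.choose P k • binomialLaurent 0 (P - k) := by
  have hcoeff (Q : R) (m : ℕ) : (binomialLaurent 0 Q).coeff m = Ring.choose Q m := by
    rw [← coeff_binomialLaurent 0 Q m, add_zero]
  refine HahnSeries.ext (funext fun n => ?_)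
  rw [hasseDeriv_coeff, coeff_smul, smul_eq_mul]
  rcases lt_or_ge n 0 with hn | hn
  · rw [coeff_binomialLaurent_of_lt hn, mul_zero]
    rcases lt_or_ge (n + k) 0 with hnk | hnk
    · rw [coeff_binomialLaurent_of_lt hnk, smul_zero]
    · lift n + k to ℕ using hnk with m hm
      rw [Ring.choose_natCast, Nat.choose_eq_zero_of_lt (by lia), Nat.cast_zero, zero_smul]
  · lift n to ℕ using hn
    have h := Ring.choose_smul_choose P (Nat.le_add_left k n)
    rw [Nat.add_sub_cancel] at h
    rw [hcoeff, ← Nat.cast_add, hcoeff, Ring.choose_natCast, natCast_zsmul, h]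

theorem hasseDeriv_binomialLaurent (q : ℤ) (P : R) (k : ℕ) :
    hasseDeriv R k (binomialLaurent q P) = ∑ ab ∈ Finset.HasAntidiagonal.antidiagonal k,
      Ring.choose q ab.1 • Ring.choose P ab.2 • binomialLaurent (q - ab.1) (P - ab.2) := by
  have h (m : ℤ) (Q : R) : binomialLaurent m Q = single m 1 * binomialLaurent 0 Q := by
    rw [binomialLaurent, binomialLaurent, single_zero_one, one_mul]
  rw [h, hasseDeriv_single_mul]
  refine Finset.sum_congr rfl fun ab _ => ?_
  rw [hasseDeriv_binomialLaurent_zero, h (q - ab.1), mul_comm _ (_ • _), ← mulLaurent_apply,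
    map_smul, mulLaurent_apply, mul_comm (single _ _)]

end LaurentSeries

section Residue

open HahnSeries LaurentSeries VertexOperator

variable {R V : Type*} [CommRing R] [AddCommGroup V] [Module R V]

/-- The residue `Res_z f(z) Y(z) w` of a Laurent series `f` times a vertex operator `Y`. -/
def residue : R⸨X⸩ →ₗ[R] VertexOperator R V →ₗ[R] V →ₗ[R] V :=
  LinearMap.mk₂ R
    (fun f Y =>
      { toFun := fun w => ((HahnModule.of R).symm (f • Y w)).coeff (-1)
        map_add' := fun w w' => by simp
        map_smul' := fun c w => by rw [LinearMap.map_smul, ← smul_comm c f]; rfl })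
    (fun f f' Y => by ext w; simp [add_smul])
    (fun c f Y => by ext w; rw [LinearMap.coe_mk, AddHom.coe_mk, smul_assoc]; rfl)
    (fun f Y Y' => by ext w; simp)
    (fun c f Y => by
      ext w
      rw [LinearMap.coe_mk, AddHom.coe_mk, LinearMap.smul_apply, ← smul_comm c f]
      rfl)

theorem residue_apply (f : R⸨X⸩) (Y : VertexOperator R V) (w : V) :
    residue f Y w = ((HahnModule.of R).symm (f • Y w)).coeff (-1) := rfl

theorem residue_single (n : ℤ) (c : R) (Y : VertexOperator R V) (w : V) :
    residue (single n c) Y w = c • (Y[[n]]) w := by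
  have h := HahnModule.coeff_single_smul_vadd (r := c) (x := Y w) (b := n) (a := -n - 1)
  rwa [vadd_eq_add, show n + (-n - 1) = -1 by ring] at h

theorem residue_mem_xAdicContinuousMaps (Y : VertexOperator R V) (w : V) :
    (residue.flip Y).flip w ∈ xAdicContinuousMaps R V := by
  refine ⟨-((HahnModule.of R).symm (Y w)).order, fun f hf => ?_⟩
  rw [LinearMap.flip_apply, LinearMap.flip_apply, residue_apply, HahnModule.coeff_smul]
  refine Finset.sum_eq_zero fun ij hij => ?_
  rw [Finset.mem_vaddAntidiagonal] at hij
  have hi := WithTop.coe_le_coe.1 (hf.trans (orderTop_le_of_coeff_ne_zero hij.1))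
  have hj := order_le_of_coeff_ne_zero hij.2.1
  have hij := hij.2.2
  rw [vadd_eq_add] at hij
  lia

theorem residue_eq_finsum (f : R⸨X⸩) (Y : VertexOperator R V) (w : V) :
    residue f Y w = ∑ᶠ i : ℤ, f.coeff i • (Y[[i]]) w := by
  simpa only [LinearMap.flip_apply, residue_single, one_smul] using
    map_eq_finsum_of_mem_xAdicContinuousMaps (residue_mem_xAdicContinuousMaps Y w) f

theorem ncoeff_residue_commutator {Y Z : VertexOperator R V} {C : ℕ → VertexOperator R V} {J : ℕ}
    {m : ℤ}
    (hYZ : ∀ (n : ℤ) (w : V), (Y[[m]]) ((Z[[n]]) w) - (Z[[n]]) ((Y[[m]]) w) =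
      ∑ j ∈ Finset.range J, Ring.choose m j • ((C j)[[m + n - j]]) w) (h : R⸨X⸩) (w : V) :
    (Y[[m]]) (residue h Z w) - residue h Z ((Y[[m]]) w) =
      ∑ j ∈ Finset.range J, residue (hasseDeriv R j (single m 1) * h) (C j) w := by
  have key : (Y[[m]]) ∘ₗ (residue.flip Z).flip w - (residue.flip Z).flip ((Y[[m]]) w) =
      ∑ j ∈ Finset.range J,
        ((residue.flip (C j)).flip w) ∘ₗ mulLaurent (hasseDeriv R j (single m 1)) := by
    refine eq_of_mem_xAdicContinuousMaps
      (sub_mem (comp_mem_xAdicContinuousMaps _ (residue_mem_xAdicContinuousMaps Z w))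
        (residue_mem_xAdicContinuousMaps Z _))
      (sum_mem fun j _ => comp_mulLaurent_mem_xAdicContinuousMaps
        (residue_mem_xAdicContinuousMaps (C j) w) _) fun n => ?_
    simp only [LinearMap.sub_apply, LinearMap.comp_apply, LinearMap.flip_apply, residue_single,
      LinearMap.sum_apply, hYZ, mulLaurent_apply, hasseDeriv_single, single_mul_single, one_mul,
      one_smul, smul_assoc]
    exact Finset.sum_congr rfl fun j _ => by rw [show n + (m - j) = m + n - j by ring]
  simpa [mulLaurent_apply, mul_comm h] using LinearMap.congr_fun key h

theorem residue_commutator {Y Z : VertexOperator R V} {C : ℕ → VertexOperator R V} {J : ℕ}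
    (hYZ : ∀ (m n : ℤ) (w : V), (Y[[m]]) ((Z[[n]]) w) - (Z[[n]]) ((Y[[m]]) w) =
      ∑ j ∈ Finset.range J, Ring.choose m j • ((C j)[[m + n - j]]) w) (f h : R⸨X⸩) (w : V) :
    residue f Y (residue h Z w) - residue h Z (residue f Y w) =
      ∑ j ∈ Finset.range J, residue (hasseDeriv R j f * h) (C j) w := by
  have key : (residue.flip Y).flip (residue h Z w) - residue h Z ∘ₗ (residue.flip Y).flip w =
      ∑ j ∈ Finset.range J,
        ((residue.flip (C j)).flip w ∘ₗ mulLaurent h) ∘ₗ hasseDeriv R j := by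
    refine eq_of_mem_xAdicContinuousMaps
      (sub_mem (residue_mem_xAdicContinuousMaps Y _)
        (comp_mem_xAdicContinuousMaps _ (residue_mem_xAdicContinuousMaps Y w)))
      (sum_mem fun j _ => comp_hasseDeriv_mem_xAdicContinuousMaps
        (comp_mulLaurent_mem_xAdicContinuousMaps (residue_mem_xAdicContinuousMaps (C j) w) h) j)
      fun m => ?_
    simpa [residue_single, mulLaurent_apply] using ncoeff_residue_commutator (hYZ m) h w
  simpa [mulLaurent_apply] using LinearMap.congr_fun key f

theorem residue_of_ncoeff_eq {Y Z : VertexOperator R V}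
    (hYZ : ∀ n : ℤ, Z[[n]] = (-n) • Y[[n - 1]]) (f : R⸨X⸩) (w : V) :
    residue f Z w = -residue (hasseDeriv R 1 f) Y w := by
  have key : (residue.flip Z).flip w = -((residue.flip Y).flip w ∘ₗ hasseDeriv R 1) := by
    refine eq_of_mem_xAdicContinuousMaps (residue_mem_xAdicContinuousMaps Z w)
      (neg_mem (comp_hasseDeriv_mem_xAdicContinuousMaps (residue_mem_xAdicContinuousMaps Y w) 1))
      fun n => ?_
    simp only [LinearMap.neg_apply, LinearMap.comp_apply, LinearMap.flip_apply, residue_single,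
      hYZ, hasseDeriv_single, Ring.choose_one_right, one_smul, smul_assoc, neg_smul,
      LinearMap.smul_apply, Nat.cast_one]
  exact LinearMap.congr_fun key f

end Residue

theorem finsum_eq_sum_range {E : Type*} [AddCommMonoid E] {f : ℕ → E} {N : ℕ}
    (h : ∀ i, N ≤ i → f i = 0) : ∑ᶠ i, f i = ∑ i ∈ Finset.range N, f i :=
  finsum_eq_sum_of_support_subset _ fun i hi => by
    contrapose! hi
    exact Function.notMem_support.2 (h i (by simpa using hi))

namespace VertexOperatorAlgebra

variable {V : Type*} [AddCommGroup V] [Module ℂ V] (A : VertexOperatorAlgebra V)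

theorem exists_mode_eq_zero (u v : V) : ∃ N : ℕ, ∀ n : ℤ, N ≤ n → A.mode u n v = 0 := by
  refine ⟨(-((HahnModule.of ℂ).symm (A.Y u v)).order).toNat, fun n hn => ?_⟩
  exact VertexOperator.ncoeff_eq_zero_of_lt_order _ _ _ (by lia)

theorem mode_commutator {u v : V} {J : ℕ} (hJ : ∀ j : ℤ, J ≤ j → A.mode u j v = 0) (m n : ℤ)
    (w : V) : A.mode u m (A.mode v n w) - A.mode v n (A.mode u m w) =
      ∑ j ∈ Finset.range J, Ring.choose m j • A.mode (A.mode u j v) (m + n - j) w := by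
  have h := A.jacobi u v w 0 m n
  have hchoose (i : ℕ) (hi : i ≠ 0) : Ring.choose ((0 : ℤ) : ℂ) i = 0 := by
    rw [Int.cast_zero, Ring.choose_zero_pos _ (Nat.pos_of_ne_zero hi)]
  have htrunc (i : ℕ) (hi : J ≤ i) : ((A.Y u)[[(0 + i : ℤ)]]) v = 0 := hJ _ (by lia)
  rw [finsum_eq_single _ 0 fun i hi => by rw [hchoose i hi, mul_zero, zero_smul],
    finsum_eq_single _ 0 fun i hi => by rw [hchoose i hi, mul_zero, zero_smul],
    finsum_eq_sum_range fun i hi => by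
      rw [htrunc i hi, map_zero, map_zero, Pi.zero_apply, LinearMap.zero_apply, smul_zero] ] at h
  have hcast (i : ℕ) : ((Ring.choose m i : ℤ) : ℂ) = Ring.choose (m : ℂ) i :=
    Ring.map_choose (Int.castRingHom ℂ) m i
  simpa [mode, ← Int.cast_smul_eq_zsmul ℂ, hcast] using h

/-- The residue `Res_z (1 + z)^P z^q Y(u, z) v`. -/
def binRes (P : ℂ) (q : ℤ) : V →ₗ[ℂ] V →ₗ[ℂ] V := residue (binomialLaurent q P) ∘ₗ A.Y

theorem binRes_apply (P : ℂ) (q : ℤ) (u v : V) :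
    A.binRes P q u v = ∑ᶠ i : ℕ, Ring.choose P i • A.mode u (i + q) v := by
  have hinj : Function.Injective fun i : ℕ => (i : ℤ) + q := fun i j h => by simpa using h
  have hF : ∀ n : ℤ, (binomialLaurent q P).coeff n • A.mode u n v =
      ∑ᶠ _ : n ∈ Set.range fun i : ℕ => (i : ℤ) + q,
        (binomialLaurent q P).coeff n • A.mode u n v := by
    intro n
    by_cases hn : n ∈ Set.range fun i : ℕ => (i : ℤ) + q
    · simp only [hn, finsum_true]
    · have hnq : n < q := by
        contrapose! hn
        exact ⟨(n - q).toNat, by lia⟩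
      simp only [hn, finsum_false, coeff_binomialLaurent_of_lt hnq, zero_smul]
  calc A.binRes P q u v = ∑ᶠ n : ℤ, (binomialLaurent q P).coeff n • A.mode u n v :=
        residue_eq_finsum _ _ _
    _ = ∑ᶠ n ∈ Set.range fun i : ℕ => (i : ℤ) + q,
          (binomialLaurent q P).coeff n • A.mode u n v := finsum_congr hF
    _ = ∑ᶠ i : ℕ, Ring.choose P i • A.mode u (i + q) v := by
        simp only [finsum_mem_range hinj, coeff_binomialLaurent]

theorem binRes_mem {P : ℂ} {q : ℤ} {u v : V} {S : Submodule ℂ V}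
    (h : ∀ i : ℕ, A.mode u (i + q) v ∈ S) : A.binRes P q u v ∈ S := by
  rw [binRes_apply]
  exact finsum_induction (· ∈ S) S.zero_mem (fun _ _ => S.add_mem) fun i => S.smul_mem _ (h i)

theorem binRes_add_one (P : ℂ) (q : ℤ) (u v : V) :
    A.binRes (P + 1) q u v = A.binRes P q u v + A.binRes P (q + 1) u v := by
  simp only [binRes, LinearMap.comp_apply, binomialLaurent_add_one, map_add, LinearMap.add_apply]

theorem binRes_commutator_mem {S : Submodule ℂ V} (P P' : ℂ) (q q' : ℤ) (u v w : V)
    (hS : ∀ a b : ℕ, A.binRes (P + P' - b) (q + q' - a) (A.mode u ((a + b : ℕ) : ℤ) v) w ∈ S) :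
    A.binRes P q u (A.binRes P' q' v w) - A.binRes P' q' v (A.binRes P q u w) ∈ S := by
  obtain ⟨J, hJ⟩ := A.exists_mode_eq_zero u v
  have h := residue_commutator (A.mode_commutator hJ) (binomialLaurent q P)
    (binomialLaurent q' P') w
  simp only [binRes, LinearMap.comp_apply]
  rw [h]
  refine S.sum_mem fun j _ => ?_
  rw [← mulLaurent_apply, hasseDeriv_binomialLaurent]
  simp only [map_sum, LinearMap.sum_apply, map_zsmul, map_smul, LinearMap.smul_apply,
    mulLaurent_apply, binomialLaurent_mul]
  refine S.sum_mem fun ab hab => zsmul_mem (S.smul_mem _ ?_) _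
  rw [← Finset.HasAntidiagonal.mem_antidiagonal.1 hab, sub_add_eq_add_sub, sub_add_eq_add_sub]
  exact hS ab.1 ab.2

theorem binRes_L_neg_one (P : ℂ) (q : ℤ) (u v : V) :
    A.binRes P q (A.mode A.omega 0 u) v =
      -((q : ℂ) • A.binRes P (q - 1) u v + P • A.binRes (P - 1) q u v) := by
  have h (n : ℤ) : (A.Y (A.mode A.omega 0 u))[[n]] = (-n) • (A.Y u)[[n - 1]] := by
    rw [← Int.cast_smul_eq_zsmul ℂ, Int.cast_neg]
    exact A.derivative u n
  rw [binRes, LinearMap.comp_apply, residue_of_ncoeff_eq h, hasseDeriv_binomialLaurent]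
  simp [Finset.Nat.antidiagonal_succ, binRes, ← Int.cast_smul_eq_zsmul ℂ, add_comm]

end VertexOperatorAlgebra

section Eigenspaces

theorem geom_sum_eq_zero_of_pow_eq_one {R : Type*} [Ring R] [NoZeroDivisors R] {x : R} {n : ℕ}
    (h : x ^ n = 1) (hx : x ≠ 1) : ∑ k ∈ Finset.range n, x ^ k = 0 := by
  have hmul := geom_sum_mul x n
  rw [h, sub_self] at hmul
  exact (mul_eq_zero.1 hmul).resolve_right (sub_ne_zero.2 hx)

variable {V : Type*} [AddCommGroup V] [Module ℂ V] {g : V ≃ₗ[ℂ] V}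

/-- The root of unity `ζ = e^{2πi/T}`, where `T` is the order of `g`. -/
def eigenRoot (g : V ≃ₗ[ℂ] V) : ℂ := Complex.exp (2 * Real.pi * Complex.I / (orderOf g : ℂ))

theorem isPrimitiveRoot_eigenRoot (hfin : IsOfFinOrder g) :
    IsPrimitiveRoot (eigenRoot g) (orderOf g) :=
  Complex.isPrimitiveRoot_exp _ hfin.orderOf_pos.ne'

theorem mem_gEigen {r : ℕ} {u : V} : u ∈ gEigen g r ↔ g u = eigenRoot g ^ r • u := by
  have h : Complex.exp (2 * Real.pi * Complex.I * r / (orderOf g : ℂ)) = eigenRoot g ^ r := by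
    rw [eigenRoot, ← Complex.exp_nat_mul]
    congr 1
    ring
  rw [gEigen, h, Module.End.mem_eigenspace_iff, LinearEquiv.coe_coe]

theorem gEigen_mod (hfin : IsOfFinOrder g) (r : ℕ) : gEigen g (r % orderOf g) = gEigen g r := by
  ext u
  rw [mem_gEigen, mem_gEigen, (isPrimitiveRoot_eigenRoot hfin).eq_orderOf, pow_mod_orderOf]

theorem pow_apply_of_mem_gEigen {r : ℕ} {u : V} (hu : u ∈ gEigen g r) (k : ℕ) :
    (g ^ k) u = (eigenRoot g ^ r) ^ k • u := by
  induction k with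
  | zero => simp
  | succ k ih =>
    rw [pow_succ', LinearEquiv.mul_apply, ih, map_smul, mem_gEigen.1 hu, smul_smul, ← pow_succ]

theorem invariantProj_of_mem_gEigen {r : ℕ} (hr : r < orderOf g) {u : V} (hu : u ∈ gEigen g r) :
    invariantProj g u = if r = 0 then u else 0 := by
  have hT : (orderOf g : ℂ) ≠ 0 := Nat.cast_ne_zero.2 (by lia)
  have hζ : IsPrimitiveRoot (eigenRoot g) (orderOf g) := Complex.isPrimitiveRoot_exp _ (by lia)
  have h : invariantProj g u =
      (orderOf g : ℂ)⁻¹ • (∑ k ∈ Finset.range (orderOf g), (eigenRoot g ^ r) ^ k) • u := by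
    simp only [invariantProj, LinearMap.smul_apply, LinearMap.sum_apply, LinearEquiv.coe_coe,
      pow_apply_of_mem_gEigen hu, Finset.sum_smul]
  split_ifs with hr0
  · simp [h, hr0, smul_smul, hT]
  · rw [h, geom_sum_eq_zero_of_pow_eq_one
      (by rw [← pow_mul, mul_comm, pow_mul, hζ.pow_eq_one, one_pow])
      (hζ.pow_ne_one_of_pos_of_lt hr0 hr), zero_smul, smul_zero]

/-- The component of `v ∈ V = ⨁ V^r` in `V^r`, as a discrete Fourier transform of
`k ↦ g ^ k v`. -/
def eigenComponent (g : V ≃ₗ[ℂ] V) (r : ℕ) (v : V) : V :=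
  (orderOf g : ℂ)⁻¹ • ∑ k ∈ Finset.range (orderOf g), ((eigenRoot g)⁻¹ ^ r) ^ k • (g ^ k) v

theorem eigenComponent_mem_gEigen (hfin : IsOfFinOrder g) (r : ℕ) (v : V) :
    eigenComponent g r v ∈ gEigen g r := by
  have hζ0 : eigenRoot g ≠ 0 := Complex.exp_ne_zero _
  have hperiod : ((eigenRoot g)⁻¹ ^ r) ^ orderOf g = 1 := by
    rw [← pow_mul, mul_comm, pow_mul, inv_pow, (isPrimitiveRoot_eigenRoot hfin).pow_eq_one,
      inv_one, one_pow]
  have hshift : ∑ k ∈ Finset.range (orderOf g),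
        ((eigenRoot g)⁻¹ ^ r) ^ (k + 1) • (g ^ (k + 1)) v =
      ∑ k ∈ Finset.range (orderOf g), ((eigenRoot g)⁻¹ ^ r) ^ k • (g ^ k) v := by
    have h := Finset.sum_range_succ (fun k => ((eigenRoot g)⁻¹ ^ r) ^ k • (g ^ k) v) (orderOf g)
    rwa [Finset.sum_range_succ', hperiod, pow_orderOf_eq_one, pow_zero, pow_zero,
      add_left_inj] at h
  rw [mem_gEigen, eigenComponent, map_smul, map_sum, smul_comm]
  congr 1
  rw [← hshift, Finset.smul_sum]
  refine Finset.sum_congr rfl fun k _ => ?_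
  rw [map_smul, smul_smul, pow_succ' ((eigenRoot g)⁻¹ ^ r), ← mul_assoc, ← mul_pow,
    mul_inv_cancel₀ hζ0, one_pow, one_mul, pow_succ' g, LinearEquiv.mul_apply]

theorem eigenComponent_mem {S : Submodule ℂ V} (hS : ∀ v ∈ S, g v ∈ S) (r : ℕ) {v : V}
    (hv : v ∈ S) : eigenComponent g r v ∈ S := by
  have hpow (k : ℕ) : (g ^ k) v ∈ S := by
    induction k with
    | zero => simpa
    | succ k ih =>
      rw [pow_succ', LinearEquiv.mul_apply]
      exact hS _ ih
  exact S.smul_mem _ (S.sum_mem fun k _ => S.smul_mem _ (hpow k))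

theorem sum_eigenComponent (hfin : IsOfFinOrder g) (v : V) :
    ∑ r ∈ Finset.range (orderOf g), eigenComponent g r v = v := by
  have hζ := (isPrimitiveRoot_eigenRoot hfin).inv
  have hT : (orderOf g : ℂ) ≠ 0 := Nat.cast_ne_zero.2 hfin.orderOf_pos.ne'
  have horth (k : ℕ) (hk : k ∈ Finset.range (orderOf g)) (hk0 : k ≠ 0) :
      ∑ r ∈ Finset.range (orderOf g), ((eigenRoot g)⁻¹ ^ r) ^ k • (g ^ k) v = 0 := by
    simp only [← Finset.sum_smul, pow_right_comm _ _ k]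
    rw [geom_sum_eq_zero_of_pow_eq_one (by rw [pow_right_comm, hζ.pow_eq_one, one_pow])
      (hζ.pow_ne_one_of_pos_of_lt hk0 (Finset.mem_range.1 hk)), zero_smul]
  simp only [eigenComponent]
  rw [← Finset.smul_sum, Finset.sum_comm,
    Finset.sum_eq_single_of_mem 0 (Finset.mem_range.2 hfin.orderOf_pos) horth]
  simp [← Nat.cast_smul_eq_nsmul ℂ, smul_smul, hT]

end Eigenspaces

namespace VertexOperatorAlgebra

variable {V : Type*} [AddCommGroup V] [Module ℂ V] {A : VertexOperatorAlgebra V}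
  {g : V ≃ₗ[ℂ] V} {m n : ℤ} {r s : ℕ} {u v : V}

section Grading

theorem mem_weightSpace : u ∈ A.weightSpace n ↔ A.mode A.omega 1 u = (n : ℂ) • u :=
  Module.End.mem_eigenspace_iff

theorem mode_L_neg_one (A : VertexOperatorAlgebra V) (u : V) (n : ℤ) :
    A.mode (A.mode A.omega 0 u) n = (-(n : ℂ)) • A.mode u (n - 1) := A.derivative u n

theorem mode_smul (A : VertexOperatorAlgebra V) (c : ℂ) (u : V) (n : ℤ) :
    A.mode (c • u) n = c • A.mode u n := by
  rw [mode, map_smul]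
  rfl

theorem mode_mem_weightSpace (hu : u ∈ A.weightSpace n) (hv : v ∈ A.weightSpace m) (k : ℤ) :
    A.mode u k v ∈ A.weightSpace (n + m - k - 1) := by
  obtain ⟨J, hJ⟩ := A.exists_mode_eq_zero A.omega u
  have hchoose (j : ℕ) : Ring.choose (1 : ℤ) (j + 2) = 0 := by
    have h := Ring.choose_natCast (R := ℤ) 1 (j + 2)
    rwa [Nat.choose_eq_zero_of_lt (by lia), Nat.cast_one, Nat.cast_zero] at h
  have h := A.mode_commutator (J := J + 2) (fun j hj => hJ j (by lia)) 1 k v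
  rw [mem_weightSpace] at hu hv ⊢
  simp only [Finset.sum_range_succ', hchoose, zero_smul, Finset.sum_const_zero, zero_add,
    Nat.cast_zero, Nat.cast_one, Ring.choose_zero_right, Ring.choose_one_right, one_smul,
    hu, hv, map_smul, mode_L_neg_one, mode_smul, LinearMap.smul_apply, sub_zero,
    add_sub_cancel_left, sub_eq_iff_eq_add] at h
  rw [h, ← add_smul, ← add_smul]
  congr 1
  push_cast
  ring

theorem map_mem_weightSpace (hg : A.IsAutomorphism g) (hu : u ∈ A.weightSpace n) :
    g u ∈ A.weightSpace n := by
  rw [mem_weightSpace] at hu ⊢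
  rw [← map_smul, ← hu, hg.map_mode, hg.map_omega]

variable (A g) in
/-- `V_n ∩ V^r`, the space of homogeneous vectors of weight `n` in `V^r`. -/
def gradedPiece (n : ℤ) (r : ℕ) : Submodule ℂ V := A.weightSpace n ⊓ gEigen g r

theorem mode_mem_gradedPiece (hg : A.IsAutomorphism g) (hu : u ∈ A.gradedPiece g n r)
    (hv : v ∈ A.gradedPiece g m s) (k : ℤ) :
    A.mode u k v ∈ A.gradedPiece g (n + m - k - 1) (r + s) := by
  refine Submodule.mem_inf.2 ⟨mode_mem_weightSpace hu.1 hv.1 k, ?_⟩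
  rw [mem_gEigen, hg.map_mode, mem_gEigen.1 hu.2, mem_gEigen.1 hv.2, mode_smul,
    LinearMap.smul_apply, map_smul, smul_smul, pow_add]

theorem vac_mem_gradedPiece (hg : A.IsAutomorphism g) : A.vac ∈ A.gradedPiece g 0 0 := by
  refine Submodule.mem_inf.2 ⟨?_, ?_⟩
  · rw [mem_weightSpace, Int.cast_zero, zero_smul]
    exact A.mode_vac_of_nonneg A.omega 1 zero_le_one
  · rw [mem_gEigen, hg.map_vac, pow_zero, one_smul]

theorem L_neg_one_mem_gradedPiece (hg : A.IsAutomorphism g) (hu : u ∈ A.gradedPiece g n r) :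
    A.mode A.omega 0 u ∈ A.gradedPiece g (n + 1) r := by
  have h := mode_mem_gradedPiece hg hu (vac_mem_gradedPiece hg) (-2)
  rw [L_neg_one_eq]
  rwa [show n + 0 - -2 - 1 = n + 1 by ring] at h

theorem homogeneous_induction (hg : A.IsAutomorphism g) (hfin : IsOfFinOrder g) {p : V → Prop}
    (mem : ∀ (n : ℤ) (r : ℕ) (u : V), r < orderOf g → u ∈ A.gradedPiece g n r → p u)
    (zero : p 0) (add : ∀ u v, p u → p v → p (u + v)) (u : V) : p u := by
  have hu : u ∈ ⨆ n, A.weightSpace n := by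
    have h : (⨆ n, A.weightSpace n) = ⊤ := A.isInternal.submodule_iSup_eq_top
    exact h ▸ Submodule.mem_top
  refine Submodule.iSup_induction _ (motive := p) hu (fun n u hu => ?_) zero add
  rw [← sum_eigenComponent hfin u]
  refine Finset.sum_induction _ p add zero fun r hr => mem n r _ (Finset.mem_range.1 hr) ⟨?_, ?_⟩
  · exact eigenComponent_mem (fun v => map_mem_weightSpace hg) r hu
  · exact eigenComponent_mem_gEigen hfin r u

end Grading

section InvariantLift

variable (A) in
/-- The isomorphism of `V` with the external direct sum of the `V_n`, through which `weightProj`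
is defined. -/
def weightEquiv : (DirectSum ℤ fun n => A.weightSpace n) ≃ₗ[ℂ] V :=
  LinearEquiv.ofBijective (DirectSum.coeLinearMap fun n => A.weightSpace n)
    A.bijective_coeLinearMap

theorem weightProj_eq (n : ℤ) (v : V) : A.weightProj n v = A.weightEquiv.symm v n := rfl

theorem weightEquiv_symm_of_mem (hu : u ∈ A.weightSpace n) :
    A.weightEquiv.symm u = DirectSum.lof ℂ ℤ (fun k => A.weightSpace k) n ⟨u, hu⟩ := by
  rw [LinearEquiv.symm_apply_eq]
  exact (DirectSum.coeLinearMap_lof _ n ⟨u, hu⟩).symm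

variable {E : Type*} [AddCommGroup E] [Module ℂ E] (L : ℤ → V →ₗ[ℂ] E)

variable (A g) in
/-- The linear map that is given by `L n` on `V_n ∩ V^0` and vanishes on `V^r` for `0 < r < T`. -/
def invariantLift : V →ₗ[ℂ] E :=
  (DirectSum.toModule ℂ ℤ E fun n => L n ∘ₗ (A.weightSpace n).subtype) ∘ₗ
    A.weightEquiv.symm.toLinearMap ∘ₗ invariantProj g

theorem invariantLift_eq_finsum (v : V) :
    A.invariantLift g L v = ∑ᶠ n : ℤ, L n (A.weightProj n (invariantProj g v)) := by
  classical
  set d := A.weightEquiv.symm (invariantProj g v) with hd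
  have hsupp : Function.support (fun n => L n (d n)) ⊆ d.support := fun n hn => by
    rw [Finset.mem_coe, DFinsupp.mem_support_iff]
    intro h0
    exact hn (by simp [h0])
  simp only [weightProj_eq, ← hd]
  rw [finsum_eq_sum_of_support_subset _ hsupp]
  rw [invariantLift, LinearMap.comp_apply, LinearMap.comp_apply, LinearEquiv.coe_coe, ← hd,
    DirectSum.toModule, DFinsupp.lsum_apply_apply, DFinsupp.sumAddHom_apply, DFinsupp.sum]
  rfl

theorem invariantLift_of_mem (hfin : IsOfFinOrder g) (hu : u ∈ A.gradedPiece g n 0) :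
    A.invariantLift g L u = L n u := by
  rw [invariantLift, LinearMap.comp_apply, LinearMap.comp_apply,
    invariantProj_of_mem_gEigen hfin.orderOf_pos hu.2, if_pos rfl, LinearEquiv.coe_coe,
    weightEquiv_symm_of_mem hu.1, DirectSum.toModule_lof]
  rfl

theorem invariantLift_of_mem_gEigen (hr0 : r ≠ 0) (hr : r < orderOf g) (hu : u ∈ gEigen g r) :
    A.invariantLift g L u = 0 := by
  rw [invariantLift, LinearMap.comp_apply, LinearMap.comp_apply,
    invariantProj_of_mem_gEigen hr hu, if_neg hr0, map_zero, map_zero]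

end InvariantLift

end VertexOperatorAlgebra

theorem neg_one_pow_mul_choose_sub {R : Type*} [CommRing R] [BinomialRing R] (m : R) (s : ℕ) :
    (-1) ^ s * Ring.choose (s - m) s = Ring.choose (m - 1) s := by
  have h := Ring.choose_neg (m - s) s
  rw [neg_sub, sub_add_cancel, Int.negOnePow_def, Units.smul_def] at h
  rw [h]
  simp [← mul_assoc, ← mul_pow]

theorem sum_choose_mul_neg_one_pow_mul_choose {R : Type*} [CommRing R] [BinomialRing R] (n m : R)
    (s : ℕ) : ∑ a ∈ Finset.range (s + 1),
      Ring.choose n a * ((-1) ^ s * Ring.choose (s - n - m) (s - a)) = Ring.choose (m - 1) s := by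
  have h := Ring.add_choose_eq s (Commute.all n (s - n - m))
  rw [Finset.Nat.sum_antidiagonal_eq_sum_range_succ
      (fun a i => Ring.choose n a * Ring.choose (s - n - m) i),
    show n + (s - n - m) = s - m by ring] at h
  rw [← neg_one_pow_mul_choose_sub, h, Finset.mul_sum]
  exact Finset.sum_congr rfl fun a _ => by ring

namespace VertexOperatorAlgebra

variable {V : Type*} [AddCommGroup V] [Module ℂ V] {A : VertexOperatorAlgebra V}
  {g : V ≃ₗ[ℂ] V} {m n : ℤ} {r : ℕ} {u v : V}

section Og

/-- The integer `δ_r`. -/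
def delta (r : ℕ) : ℤ := if r = 0 then 1 else 0

theorem delta_nonneg (r : ℕ) : 0 ≤ delta r := by
  unfold delta
  split_ifs <;> norm_num

theorem circ_eq_binRes (n : ℤ) (r : ℕ) (u v : V) : A.circ g n r u v =
    A.binRes ((n : ℂ) - 1 + (r : ℂ) / (orderOf g : ℂ) + delta r) (-1 - delta r) u v := by
  rw [circ, binRes_apply]
  refine finsum_congr fun i => ?_
  congr 2
  · rw [delta]
    push_cast
    ring
  · rw [delta]
    ring_nf

theorem circ_mem_Og (hr : r < orderOf g) (hu : u ∈ A.gradedPiece g n r) (v : V) :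
    A.circ g n r u v ∈ A.Og g := Submodule.subset_span ⟨n, r, u, v, hr, hu.1, hu.2, rfl⟩

theorem binRes_delta_mem_Og (hg : A.IsAutomorphism g) (hr : r < orderOf g)
    (hu : u ∈ A.gradedPiece g n r) {q : ℤ} (hq : q ≤ -1 - delta r) (v : V) :
    A.binRes ((n : ℂ) - 1 + (r : ℂ) / (orderOf g : ℂ) + delta r) q u v ∈ A.Og g := by
  induction q, hq using Int.leInductionDown generalizing n u with
  | base =>
    rw [← circ_eq_binRes]
    exact circ_mem_Og hr hu v
  | pred q hq ih =>
    set P : ℂ := (n : ℂ) - 1 + (r : ℂ) / (orderOf g : ℂ) + delta r with hP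
    have hL : A.binRes (P + 1) q (A.mode A.omega 0 u) v ∈ A.Og g := by
      have h := ih (L_neg_one_mem_gradedPiece hg hu)
      rwa [show ((n + 1 : ℤ) : ℂ) - 1 + (r : ℂ) / (orderOf g : ℂ) + delta r = P + 1 by
        rw [hP]
        push_cast
        ring] at h
    have hq0 : (q : ℂ) ≠ 0 := Int.cast_ne_zero.2 (by linarith [delta_nonneg r])
    rw [binRes_L_neg_one, Submodule.neg_mem_iff, add_sub_cancel_right,
      Submodule.add_mem_iff_left _ (Submodule.smul_mem _ _ (ih hu)),
      Submodule.smul_mem_iff _ hq0, binRes_add_one, sub_add_cancel,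
      Submodule.add_mem_iff_left _ (ih hu)] at hL
    exact hL

theorem binRes_mem_Og (hg : A.IsAutomorphism g) (hr : r < orderOf g)
    (hu : u ∈ A.gradedPiece g n r) {k q : ℤ} (hk : delta r ≤ k) (hkq : k + q ≤ -1) {P : ℂ}
    (hP : P = (n : ℂ) - 1 + (r : ℂ) / (orderOf g : ℂ) + k) (v : V) :
    A.binRes P q u v ∈ A.Og g := by
  subst hP
  induction k, hk using Int.leInduction generalizing q with
  | base => exact binRes_delta_mem_Og hg hr hu (by lia) v
  | succ k _ ih =>
    rw [Int.cast_add, Int.cast_one, ← add_assoc, binRes_add_one]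
    exact Submodule.add_mem _ (ih (by lia)) (ih (by lia))

theorem binRes_vac_right (P : ℂ) (u : V) : A.binRes P (-1) u A.vac = u := by
  rw [binRes_apply, finsum_eq_single _ 0 fun i hi => by
    rw [mode, A.mode_vac_of_nonneg u _ (by lia), smul_zero] ]
  rw [Ring.choose_zero_right, one_smul]
  exact A.mode_vac u

theorem binRes_vac_left (P : ℂ) (v : V) : A.binRes P (-1) A.vac v = v := by
  rw [binRes_apply, finsum_eq_single _ 0 fun i hi => by
    rw [mode, A.vac_mode, if_neg (by lia), LinearMap.zero_apply, smul_zero] ]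
  rw [mode, A.vac_mode, if_pos (by simp), Ring.choose_zero_right, one_smul, Module.End.one_apply]

theorem mem_Og_of_mem_gradedPiece (hg : A.IsAutomorphism g) (hr0 : r ≠ 0) (hr : r < orderOf g)
    (hu : u ∈ A.gradedPiece g n r) : u ∈ A.Og g := by
  rw [← A.binRes_vac_right _ u]
  exact binRes_mem_Og hg hr hu (k := 0) (by simp [delta, hr0]) (by norm_num) rfl A.vac

theorem binRes_commutator_mem_Og (hg : A.IsAutomorphism g) (hr : r < orderOf g)
    (hu : u ∈ A.gradedPiece g n 0) (hv : v ∈ A.gradedPiece g m r) {p k q q' : ℤ}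
    (hk : delta r ≤ p + k) (hkq : p + k + (q + q') ≤ -1) {P P' : ℂ} (hP : P = (n : ℂ) - 1 + p)
    (hP' : P' = (m : ℂ) - 1 + (r : ℂ) / (orderOf g : ℂ) + k) (w : V) :
    A.binRes P q u (A.binRes P' q' v w) - A.binRes P' q' v (A.binRes P q u w) ∈ A.Og g := by
  refine A.binRes_commutator_mem P P' q q' u v w fun a b => ?_
  have huv := mode_mem_gradedPiece hg hu hv ((a + b : ℕ) : ℤ)
  rw [zero_add] at huv
  refine binRes_mem_Og hg hr huv (k := p + k + a) (by lia) (by lia) ?_ w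
  rw [hP, hP']
  push_cast
  ring

theorem binRes_mem_Og_of_mem_Og (hg : A.IsAutomorphism g) (hu : u ∈ A.gradedPiece g n 0)
    {p q : ℤ} (hp : 0 ≤ p) (hpq : p + q ≤ 0) {P : ℂ} (hP : P = (n : ℂ) - 1 + p)
    (hv : v ∈ A.Og g) : A.binRes P q u v ∈ A.Og g := by
  induction hv using Submodule.span_induction with
  | zero => simp
  | add x y _ _ hx hy => simpa using Submodule.add_mem _ hx hy
  | smul c x _ hx => simpa using Submodule.smul_mem _ c hx
  | mem x hx =>
    obtain ⟨m, r, v, w, hr, hm, hv, rfl⟩ := hx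
    have hcirc := circ_mem_Og hr ⟨hm, hv⟩ (A.binRes P q u w)
    rw [circ_eq_binRes] at hcirc ⊢
    rw [← Submodule.sub_mem_iff_left _ hcirc]
    exact binRes_commutator_mem_Og hg hr hu ⟨hm, hv⟩ (by lia) (by lia) hP rfl w

end Og

section Skew

theorem L_neg_one_smodEq (hg : A.IsAutomorphism g) (hfin : IsOfFinOrder g)
    (hu : u ∈ A.gradedPiece g n 0) : A.mode A.omega 0 u ≡ (-n : ℂ) • u [SMOD A.Og g] := by
  have h := binRes_mem_Og hg hfin.orderOf_pos hu (k := 1) (q := -2) (by simp [delta])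
    (by norm_num) rfl A.vac
  rw [binRes_apply, finsum_eq_sum_range (N := 2) fun i hi => by
    rw [mode, A.mode_vac_of_nonneg u _ (by lia), smul_zero] ] at h
  have hvac : A.mode u (-1) A.vac = u := A.mode_vac u
  rw [SModEq.sub_mem, neg_smul, sub_neg_eq_add]
  simpa [Finset.sum_range_succ, hvac, ← A.L_neg_one_eq] using h

theorem mode_vac_smodEq (hg : A.IsAutomorphism g) (hfin : IsOfFinOrder g)
    (hu : u ∈ A.gradedPiece g n 0) (i : ℕ) :
    A.mode u (-1 - i) A.vac ≡ Ring.choose (-n : ℂ) i • u [SMOD A.Og g] := by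
  induction i generalizing n u with
  | zero =>
    rw [Nat.cast_zero, sub_zero, Ring.choose_zero_right, one_smul]
    exact congrArg _ (A.mode_vac u)
  | succ i ih =>
    have hi : (i + 1 : ℂ) ≠ 0 := Nat.cast_add_one_ne_zero i
    have hL : A.mode (A.mode A.omega 0 u) (-1 - i) A.vac =
        (i + 1 : ℂ) • A.mode u (-1 - (i + 1 : ℕ)) A.vac := by
      rw [mode_L_neg_one, LinearMap.smul_apply]
      push_cast
      ring_nf
    have hchoose : (i + 1 : ℂ) * Ring.choose (-n : ℂ) (i + 1) =
        Ring.choose (-(n + 1 : ℤ) : ℂ) i * (-n) := by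
      have h := Ring.choose_smul_choose (-n : ℂ) (Nat.succ_le_succ (Nat.zero_le i))
      rw [Int.cast_add, Int.cast_one, neg_add', mul_comm _ (-n : ℂ)]
      simpa using h
    calc A.mode u (-1 - (i + 1 : ℕ)) A.vac
        = (i + 1 : ℂ)⁻¹ • A.mode (A.mode A.omega 0 u) (-1 - i) A.vac := by
          rw [hL, inv_smul_smul₀ hi]
      _ ≡ (i + 1 : ℂ)⁻¹ • Ring.choose (-(n + 1 : ℤ) : ℂ) i • A.mode A.omega 0 u [SMOD A.Og g] :=
          (ih (L_neg_one_mem_gradedPiece hg hu)).smul _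
      _ ≡ (i + 1 : ℂ)⁻¹ • Ring.choose (-(n + 1 : ℤ) : ℂ) i • (-n : ℂ) • u [SMOD A.Og g] :=
          ((L_neg_one_smodEq hg hfin hu).smul _).smul _
      _ = Ring.choose (-n : ℂ) (i + 1) • u := by
          rw [smul_smul, smul_smul, mul_assoc, ← hchoose, inv_mul_cancel_left₀ hi]

/-- Skew-symmetry `Y(u, z)v = e^{zL(-1)} Y(v, -z)u`, with `L(-1)^i x / i!` written as
`x_{-1-i} 𝟏`. -/
theorem mode_skew (u v : V) (l : ℤ) : A.mode u l v =
    ∑ᶠ i : ℕ, (-(-1 : ℂ) ^ (l + i)) • A.mode (A.mode v (l + i) u) (-1 - i) A.vac := by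
  have h := A.jacobi v u A.vac l (-1) 0
  have hchoose (i : ℕ) : Ring.choose ((-1 : ℤ) : ℂ) i = (-1) ^ i := by
    have h := Ring.choose_neg' (1 : ℂ) i
    rw [Ring.multichoose_one] at h
    simpa [Int.negOnePow_def, Units.smul_def] using h
  have hsq : (-1 : ℂ) ^ l * (-1 : ℂ) ^ l = 1 := by rw [← mul_zpow, neg_mul_neg, one_mul, one_zpow]
  rw [finsum_eq_zero_of_forall_eq_zero fun i => by
      rw [A.mode_vac_of_nonneg u _ (by lia), map_zero, smul_zero],
    finsum_eq_single _ 0 fun i hi => by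
      rw [A.mode_vac_of_nonneg v _ (by lia), map_zero, smul_zero] ] at h
  simp only [hchoose, Nat.cast_zero, add_zero, sub_zero, zero_add, zero_sub, pow_zero, mul_one,
    Ring.choose_zero_right, A.mode_vac] at h
  calc A.mode u l v = (-(-1 : ℂ) ^ l) • -((-1 : ℂ) ^ l • A.mode u l v) := by
        rw [smul_neg, neg_smul, neg_neg, smul_smul, hsq, one_smul]
    _ = (-(-1 : ℂ) ^ l) • ∑ᶠ i : ℕ, (-1 : ℂ) ^ i • A.mode (A.mode v (l + i) u) (-1 - i) A.vac :=
        congrArg _ h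
    _ = _ := by
        rw [smul_finsum]
        refine finsum_congr fun i => ?_
        rw [smul_smul, zpow_add₀ (by norm_num), zpow_natCast, neg_mul]

theorem mode_skew_smodEq (hg : A.IsAutomorphism g) (hfin : IsOfFinOrder g)
    (hu : u ∈ A.gradedPiece g n 0) (hv : v ∈ A.gradedPiece g m 0) {N : ℕ}
    (hN : ∀ j : ℕ, N ≤ j → A.mode v (j - 1) u = 0) (a : ℕ) :
    A.mode u (a - 1) v ≡ ∑ i ∈ Finset.range (N - a),
      ((-1) ^ (a + i) * Ring.choose (((a + i : ℕ) : ℂ) - n - m) i) •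
        A.mode v ((a + i : ℕ) - 1) u [SMOD A.Og g] := by
  have hindex (i : ℕ) : (a : ℤ) - 1 + i = (a + i : ℕ) - 1 := by
    push_cast
    ring
  have hsign (i : ℕ) : -(-1 : ℂ) ^ (((a + i : ℕ) : ℤ) - 1) = (-1) ^ (a + i) := by
    rw [zpow_sub_one₀ (by norm_num), zpow_natCast]
    norm_num
  rw [mode_skew, finsum_eq_sum_range (N := N - a) fun i hi => by
    rw [hindex, hN _ (by lia), mode, map_zero, map_zero, Pi.zero_apply, LinearMap.zero_apply,
      smul_zero] ]
  refine SModEq.sum fun i _ => ?_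
  have h := mode_vac_smodEq hg hfin (mode_mem_gradedPiece hg hv hu ((a + i : ℕ) - 1)) i
  rw [hindex, hsign, mul_smul]
  convert h.smul _ using 4
  push_cast
  ring

/-- The substitution `z ↦ -z / (1 + z)` in `Y(u, z)v = e^{zL(-1)} Y(v, -z)u`, where `e^{zL(-1)}`
acts on vectors of weight `k` as `(1 + z)^{-k}` modulo `O_g(V)`. -/
theorem binRes_skew_smodEq (hg : A.IsAutomorphism g) (hfin : IsOfFinOrder g)
    (hu : u ∈ A.gradedPiece g n 0) (hv : v ∈ A.gradedPiece g m 0) :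
    A.binRes n (-1) u v ≡ A.binRes (m - 1) (-1) v u [SMOD A.Og g] := by
  obtain ⟨N, hN⟩ := A.exists_mode_eq_zero u v
  obtain ⟨N', hN'⟩ := A.exists_mode_eq_zero v u
  have hbound (j : ℕ) (hj : N + N' + 1 ≤ j) : A.mode v (j - 1) u = 0 := hN' _ (by lia)
  calc A.binRes n (-1) u v
      = ∑ a ∈ Finset.range (N + N' + 1), Ring.choose (n : ℂ) a • A.mode u (a - 1) v := by
        rw [binRes_apply]
        exact finsum_eq_sum_range fun i hi => by rw [hN _ (by lia), smul_zero]
    _ ≡ ∑ a ∈ Finset.range (N + N' + 1), Ring.choose (n : ℂ) a •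
          ∑ i ∈ Finset.range (N + N' + 1 - a),
            ((-1) ^ (a + i) * Ring.choose (((a + i : ℕ) : ℂ) - n - m) i) •
              A.mode v ((a + i : ℕ) - 1) u [SMOD A.Og g] :=
        SModEq.sum fun a _ => (mode_skew_smodEq hg hfin hu hv hbound a).smul _
    _ = ∑ s ∈ Finset.range (N + N' + 1), Ring.choose (m - 1 : ℂ) s • A.mode v (s - 1) u := by
        simp only [Finset.smul_sum, smul_smul]
        rw [← Finset.sum_range_diag_flip]
        refine Finset.sum_congr rfl fun s _ => ?_
        rw [← sum_choose_mul_neg_one_pow_mul_choose (n : ℂ), Finset.sum_smul]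
        refine Finset.sum_congr rfl fun a ha => ?_
        rw [Nat.add_sub_cancel' (Finset.mem_range_succ_iff.1 ha)]
    _ = A.binRes (m - 1) (-1) v u := by
        rw [binRes_apply]
        exact (finsum_eq_sum_range fun i hi => by rw [hbound i hi, smul_zero]).symm

end Skew

section Algebra

variable {w : V}

theorem map_invariantLift {E F : Type*} [AddCommGroup E] [Module ℂ E] [AddCommGroup F]
    [Module ℂ F] (φ : E →ₗ[ℂ] F) (L : ℤ → V →ₗ[ℂ] E) (v : V) :
    φ (A.invariantLift g L v) = A.invariantLift g (fun n => φ ∘ₗ L n) v := by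
  have h : φ ∘ₗ DirectSum.toModule ℂ ℤ E (fun n => L n ∘ₗ (A.weightSpace n).subtype) =
      DirectSum.toModule ℂ ℤ F fun n => (φ ∘ₗ L n) ∘ₗ (A.weightSpace n).subtype := by
    refine DirectSum.linearMap_ext ℂ fun n => ?_
    ext x
    simp
  exact LinearMap.congr_fun h _

theorem invariant_induction (hg : A.IsAutomorphism g) (hfin : IsOfFinOrder g) {p : V → Prop}
    (invariant : ∀ (n : ℤ) (u : V), u ∈ A.gradedPiece g n 0 → p u)
    (twisted : ∀ (n : ℤ) (r : ℕ) (u : V), r ≠ 0 → r < orderOf g → u ∈ A.gradedPiece g n r → p u)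
    (zero : p 0) (add : ∀ u v, p u → p v → p (u + v)) (u : V) : p u := by
  induction u using homogeneous_induction hg hfin with
  | mem n r u hr hu =>
    rcases eq_or_ne r 0 with rfl | hr0
    exacts [invariant n u hu, twisted n r u hr0 hr hu]
  | zero => exact zero
  | add u v hu hv => exact add u v hu hv

theorem invariantLift_mem (hg : A.IsAutomorphism g) (hfin : IsOfFinOrder g) {E : Type*}
    [AddCommGroup E] [Module ℂ E] {L : ℤ → V →ₗ[ℂ] E} {S : Submodule ℂ E}
    (h : ∀ n, ∀ u ∈ A.gradedPiece g n 0, L n u ∈ S) (u : V) : A.invariantLift g L u ∈ S := by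
  induction u using invariant_induction hg hfin with
  | invariant n u hu =>
    rw [invariantLift_of_mem L hfin hu]
    exact h n u hu
  | twisted n r u hr0 hr hu =>
    rw [invariantLift_of_mem_gEigen L hr0 hr hu.2]
    exact S.zero_mem
  | zero => simp
  | add u v hu hv => simpa using S.add_mem hu hv

variable (A g) in
/-- The product `*_g` as a bilinear map, `u ↦ (v ↦ u *_g v)`. -/
def starLeft : V →ₗ[ℂ] V →ₗ[ℂ] V := A.invariantLift g fun n => A.binRes n (-1)

variable (A g) in
/-- The map `v ↦ Res_z (1 + z)^{wt v - 1} z⁻¹ Y(v, z)` on `V^0`, extended by `0` to the other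
`V^r`. Modulo `O_g(V)` it is right multiplication by `v`. -/
def starRight : V →ₗ[ℂ] V →ₗ[ℂ] V := A.invariantLift g fun n => A.binRes (n - 1) (-1)

theorem starProduct_eq_starLeft (u v : V) : A.starProduct g u v = A.starLeft g u v := by
  refine Eq.trans ?_ (map_invariantLift (LinearMap.applyₗ v) _ u).symm
  rw [invariantLift_eq_finsum]
  exact finsum_congr fun n => (A.binRes_apply n (-1) _ v).symm

theorem starLeft_mem_compatibleMaps (hg : A.IsAutomorphism g) (hfin : IsOfFinOrder g) (u : V) :
    A.starLeft g u ∈ (A.Og g).compatibleMaps (A.Og g) :=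
  invariantLift_mem hg hfin (S := (A.Og g).compatibleMaps (A.Og g)) (fun _ _ hu _ =>
    binRes_mem_Og_of_mem_Og hg hu zero_le_one (by norm_num) (by simp)) u

theorem starRight_mem_compatibleMaps (hg : A.IsAutomorphism g) (hfin : IsOfFinOrder g) (u : V) :
    A.starRight g u ∈ (A.Og g).compatibleMaps (A.Og g) :=
  invariantLift_mem hg hfin (S := (A.Og g).compatibleMaps (A.Og g)) (fun _ _ hu _ =>
    binRes_mem_Og_of_mem_Og hg hu le_rfl (by norm_num) (by simp)) u

theorem starLeft_smodEq (hg : A.IsAutomorphism g) (hfin : IsOfFinOrder g) (u : V)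
    (h : v ≡ w [SMOD A.Og g]) : A.starLeft g u v ≡ A.starLeft g u w [SMOD A.Og g] := by
  rw [SModEq.sub_mem, ← map_sub]
  exact starLeft_mem_compatibleMaps hg hfin u (SModEq.sub_mem.1 h)

theorem starLeft_smodEq_starRight (hg : A.IsAutomorphism g) (hfin : IsOfFinOrder g) (u v : V) :
    A.starLeft g u v ≡ A.starRight g v u [SMOD A.Og g] := by
  induction u using invariant_induction hg hfin with
  | invariant n u hu =>
    induction v using invariant_induction hg hfin with
    | invariant m v hv =>
      rw [starLeft, starRight, invariantLift_of_mem _ hfin hu, invariantLift_of_mem _ hfin hv]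
      exact binRes_skew_smodEq hg hfin hu hv
    | twisted m s v hs0 hs hv =>
      rw [starRight, invariantLift_of_mem_gEigen _ hs0 hs hv.2, LinearMap.zero_apply, SModEq.zero]
      exact starLeft_mem_compatibleMaps hg hfin u (mem_Og_of_mem_gradedPiece hg hs0 hs hv)
    | zero => simp
    | add v w hv hw => simpa using hv.add hw
  | twisted n r u hr0 hr hu =>
    rw [starLeft, invariantLift_of_mem_gEigen _ hr0 hr hu.2, LinearMap.zero_apply, SModEq.comm,
      SModEq.zero]
    exact starRight_mem_compatibleMaps hg hfin v (mem_Og_of_mem_gradedPiece hg hr0 hr hu)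
  | zero => simp
  | add u w hu hw => simpa using hu.add hw

theorem starLeft_starRight_smodEq (hg : A.IsAutomorphism g) (hfin : IsOfFinOrder g) (u v w : V) :
    A.starLeft g u (A.starRight g w v) ≡ A.starRight g w (A.starLeft g u v) [SMOD A.Og g] := by
  induction u using invariant_induction hg hfin with
  | invariant n u hu =>
    induction w using invariant_induction hg hfin with
    | invariant m w hw =>
      rw [starLeft, starRight, invariantLift_of_mem _ hfin hu, invariantLift_of_mem _ hfin hw,
        SModEq.sub_mem]
      exact binRes_commutator_mem_Og hg hfin.orderOf_pos hu hw (p := 1) (k := 0) (by simp [delta])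
        (by norm_num) (by simp) (by simp) v
    | twisted m s w hs0 hs hw => simp [starRight, invariantLift_of_mem_gEigen _ hs0 hs hw.2]
    | zero => simp
    | add w w' hw hw' => simpa using hw.add hw'
  | twisted n r u hr0 hr hu => simp [starLeft, invariantLift_of_mem_gEigen _ hr0 hr hu.2]
  | zero => simp
  | add u u' hu hu' => simpa using hu.add hu'

theorem starLeft_assoc_smodEq (hg : A.IsAutomorphism g) (hfin : IsOfFinOrder g) (u v w : V) :
    A.starLeft g (A.starLeft g u v) w ≡ A.starLeft g u (A.starLeft g v w) [SMOD A.Og g] :=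
  calc A.starLeft g (A.starLeft g u v) w
      ≡ A.starRight g w (A.starLeft g u v) [SMOD A.Og g] := starLeft_smodEq_starRight hg hfin _ w
    _ ≡ A.starLeft g u (A.starRight g w v) [SMOD A.Og g] :=
        (starLeft_starRight_smodEq hg hfin u v w).symm
    _ ≡ A.starLeft g u (A.starLeft g v w) [SMOD A.Og g] :=
        starLeft_smodEq hg hfin u (starLeft_smodEq_starRight hg hfin v w).symm

theorem starLeft_vac (hg : A.IsAutomorphism g) (hfin : IsOfFinOrder g) (v : V) :
    A.starLeft g A.vac v = v := by
  rw [starLeft, invariantLift_of_mem _ hfin (vac_mem_gradedPiece hg), binRes_vac_left]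

theorem starRight_vac (hg : A.IsAutomorphism g) (hfin : IsOfFinOrder g) (v : V) :
    A.starRight g A.vac v = v := by
  rw [starRight, invariantLift_of_mem _ hfin (vac_mem_gradedPiece hg), binRes_vac_left]

theorem starLeft_mem_Og (hg : A.IsAutomorphism g) (hfin : IsOfFinOrder g) (hu : u ∈ A.Og g)
    (v : V) : A.starLeft g u v ∈ A.Og g :=
  SModEq.zero.1 <| (starLeft_smodEq_starRight hg hfin u v).trans <|
    SModEq.zero.2 <| starRight_mem_compatibleMaps hg hfin v hu

/-- The product on `A_g(V)` induced by `*_g`. -/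
def agMul (hg : A.IsAutomorphism g) (hfin : IsOfFinOrder g) :
    A.Ag g →ₗ[ℂ] A.Ag g →ₗ[ℂ] A.Ag g :=
  (A.Og g).liftQ ((A.Og g).mapQLinear (A.Og g) ∘ₗ
    (A.starLeft g).codRestrict _ (starLeft_mem_compatibleMaps hg hfin)) fun u hu => by
      ext v
      exact (Submodule.Quotient.mk_eq_zero _).2 (starLeft_mem_Og hg hfin hu v)

theorem agMul_mkQ (hg : A.IsAutomorphism g) (hfin : IsOfFinOrder g) (u v : V) :
    agMul hg hfin ((A.Og g).mkQ u) ((A.Og g).mkQ v) = (A.Og g).mkQ (A.starLeft g u v) := rfl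

theorem agMul_assoc (hg : A.IsAutomorphism g) (hfin : IsOfFinOrder g) (x y z : A.Ag g) :
    agMul hg hfin (agMul hg hfin x y) z = agMul hg hfin x (agMul hg hfin y z) := by
  obtain ⟨u, rfl⟩ := (A.Og g).mkQ_surjective x
  obtain ⟨v, rfl⟩ := (A.Og g).mkQ_surjective y
  obtain ⟨w, rfl⟩ := (A.Og g).mkQ_surjective z
  exact starLeft_assoc_smodEq hg hfin u v w

theorem agMul_vac_left (hg : A.IsAutomorphism g) (hfin : IsOfFinOrder g) (x : A.Ag g) :
    agMul hg hfin ((A.Og g).mkQ A.vac) x = x := by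
  obtain ⟨u, rfl⟩ := (A.Og g).mkQ_surjective x
  rw [agMul_mkQ, starLeft_vac hg hfin]

theorem agMul_vac_right (hg : A.IsAutomorphism g) (hfin : IsOfFinOrder g) (x : A.Ag g) :
    agMul hg hfin x ((A.Og g).mkQ A.vac) = x := by
  obtain ⟨u, rfl⟩ := (A.Og g).mkQ_surjective x
  calc agMul hg hfin ((A.Og g).mkQ u) ((A.Og g).mkQ A.vac)
      = (A.Og g).mkQ (A.starRight g A.vac u) := starLeft_smodEq_starRight hg hfin u A.vac
    _ = (A.Og g).mkQ u := by rw [starRight_vac hg hfin]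

end Algebra

end VertexOperatorAlgebra

namespace WeakTwistedModule

open VertexOperatorAlgebra

variable {V : Type*} [AddCommGroup V] [Module ℂ V] {A : VertexOperatorAlgebra V}
  {g : V ≃ₗ[ℂ] V} {M : Type*} [AddCommGroup M] [Module ℂ M] (W : WeakTwistedModule A g M)
  {m n : ℤ} {r s : ℕ} {u v : V} {w : M}

theorem action_mk (q : ℚ) (a : V) (h : Finsupp.single q a ∈ A.loopSpace g) :
    W.action (Submodule.Quotient.mk ⟨Finsupp.single q a, h⟩) = W.mode a q :=
  W.loopAction_single q a

variable {W} in
theorem mode_eq_zero_of_mem_Omega (hw : w ∈ W.Omega) (hr : r < orderOf g)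
    (hu : u ∈ A.gradedPiece g n r) {q : ℚ} (hq : (n : ℚ) - q - 1 < 0) : W.mode u q w = 0 := by
  by_cases h : ∃ k : ℤ, q = (r : ℚ) / (orderOf g : ℚ) + k
  · obtain ⟨k, rfl⟩ := h
    rw [← W.action_mk _ u (Submodule.subset_span ⟨r, k, u, hr, hu.2, rfl⟩)]
    exact hw _ (Submodule.subset_span ⟨n, r, k, u, hr, hu.2, hu.1, hq, rfl⟩)
  · rw [W.mode_eq_zero r hr u hu.2 q (not_exists.1 h), LinearMap.zero_apply]

theorem mem_Omega (h : ∀ (n : ℤ) (r : ℕ) (u : V) (q : ℚ), r < orderOf g →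
    u ∈ A.gradedPiece g n r → (n : ℚ) - q - 1 < 0 → W.mode u q w = 0) : w ∈ W.Omega := by
  intro x hx
  induction hx using Submodule.span_induction with
  | zero => simp
  | add x y _ _ hx hy => simp [hx, hy]
  | smul c x _ hx => simp [hx]
  | mem x hx =>
    obtain ⟨n, r, k, a, hr, ha, hn, hq, rfl⟩ := hx
    exact (LinearMap.congr_fun (W.action_mk _ a _) w).trans (h n r a _ hr ⟨hn, ha⟩ hq)

theorem mode_commutator (hfin : IsOfFinOrder g) (hu : u ∈ gEigen g 0) (k : ℤ) (q : ℚ) (v : V)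
    (w : M) : W.mode u k (W.mode v q w) - W.mode v q (W.mode u k w) =
      ∑ᶠ i : ℕ, Ring.choose (k : ℂ) i • W.mode (A.mode u i v) (k + q - i) w := by
  have h := W.jacobi 0 hfin.orderOf_pos u hu v w 0 k k q (by simp)
  have hchoose (i : ℕ) (hi : i ≠ 0) : Ring.choose ((0 : ℤ) : ℂ) i = 0 := by
    rw [Int.cast_zero, Ring.choose_zero_pos _ (Nat.pos_of_ne_zero hi)]
  rw [finsum_eq_single _ 0 fun i hi => by rw [hchoose i hi, mul_zero, zero_smul],
    finsum_eq_single _ 0 fun i hi => by rw [hchoose i hi, mul_zero, zero_smul] ] at h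
  simpa using h

/-- The zero mode `v ↦ ∑ (v_n)_{n-1}`, where `v_n` is the component of `v` in `V_n ∩ V^0`; it
extends `a ↦ o(a)` to all of `V`. -/
def zeroMode : V →ₗ[ℂ] Module.End ℂ M :=
  A.invariantLift g fun n => LinearMap.proj ((n - 1 : ℤ) : ℚ) ∘ₗ W.mode

theorem zeroMode_of_mem (hfin : IsOfFinOrder g) (hu : u ∈ A.gradedPiece g n 0) :
    W.zeroMode u = W.mode u ((n - 1 : ℤ) : ℚ) := invariantLift_of_mem _ hfin hu

theorem zeroMode_of_mem_gEigen (hr0 : r ≠ 0) (hr : r < orderOf g) (hu : u ∈ gEigen g r) :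
    W.zeroMode u = 0 := invariantLift_of_mem_gEigen _ hr0 hr hu

theorem mode_mem_Omega (hg : A.IsAutomorphism g) (hfin : IsOfFinOrder g)
    (hu : u ∈ A.gradedPiece g n 0) (hw : w ∈ W.Omega) :
    W.mode u ((n - 1 : ℤ) : ℚ) w ∈ W.Omega := by
  refine W.mem_Omega fun m s v q hs hv hq => ?_
  have hterm (i : ℕ) : W.mode (A.mode u i v) ((n - 1 : ℤ) + q - i) w = 0 := by
    have huv := mode_mem_gradedPiece hg hu hv i
    rw [zero_add] at huv
    refine mode_eq_zero_of_mem_Omega hw hs huv ?_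
    push_cast
    linarith
  have h := W.mode_commutator hfin hu.2 (n - 1) q v w
  rw [mode_eq_zero_of_mem_Omega hw hs hv hq, map_zero, zero_sub,
    finsum_eq_zero_of_forall_eq_zero fun i => by rw [hterm i, smul_zero], neg_eq_zero] at h
  exact h

theorem zeroMode_mem_Omega (hg : A.IsAutomorphism g) (hfin : IsOfFinOrder g) (u : V)
    (hw : w ∈ W.Omega) : W.zeroMode u w ∈ W.Omega :=
  invariantLift_mem hg hfin (S := W.Omega.compatibleMaps W.Omega)
    (fun _ _ hu _ => W.mode_mem_Omega hg hfin hu) u hw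

/-- Read from right to left: the Jacobi identity for `Y(u, z₁)` and `Y(v, z₂)` applied to
`w ∈ Ω(M)`, in the coefficients where all terms on the right are zero modes. -/
theorem zeroMode_binRes (hg : A.IsAutomorphism g) (hfin : IsOfFinOrder g) (hr : r < orderOf g)
    (hu : u ∈ A.gradedPiece g n r) (hv : v ∈ A.gradedPiece g m s)
    (hrs : (r + s) % orderOf g = 0) (hw : w ∈ W.Omega) {P : ℂ} {p q : ℚ} (k l : ℤ)
    (hP : P = p) (hp : p = (r : ℚ) / (orderOf g : ℚ) + k) (hnp : (n : ℚ) - p - 1 < 0)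
    (hpq : p + q = n + m - l - 2) :
    W.zeroMode (A.binRes P l u v) w = ∑ᶠ i : ℕ, ((-1 : ℂ) ^ i * Ring.choose (l : ℂ) i) •
      W.mode u (p + l - i) (W.mode v (q + i) w) := by
  obtain ⟨N, hN⟩ := A.exists_mode_eq_zero u v
  have htrunc (i : ℕ) (hi : (N - l).toNat ≤ i) : A.mode u (l + i) v = 0 := hN _ (by lia)
  have hzero (i : ℕ) : W.mode u (p + i) w = 0 := by
    refine mode_eq_zero_of_mem_Omega hw hr hu ?_
    have : (0 : ℚ) ≤ i := Nat.cast_nonneg i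
    linarith
  have hmode (i : ℕ) : W.zeroMode (A.mode u (l + i) v) =
      W.mode (A.mode u (l + i) v) (p + q - i) := by
    have huv := mode_mem_gradedPiece hg hu hv (l + i)
    rw [gradedPiece, ← gEigen_mod hfin, hrs] at huv
    rw [W.zeroMode_of_mem hfin huv]
    exact congrArg (W.mode _) (by rw [hpq]; push_cast; ring)
  have h := W.jacobi r hr u hu.2 v w l k p q hp
  rw [finsum_eq_zero_of_forall_eq_zero (f := fun i : ℕ =>
      ((-1 : ℂ) ^ l * (-1 : ℂ) ^ i * Ring.choose (l : ℂ) i) • _)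
      fun i => by rw [hzero i, map_zero, smul_zero], sub_zero] at h
  rw [h, hP, binRes_apply, finsum_eq_sum_range fun i hi => by
      rw [add_comm, htrunc i hi, smul_zero],
    finsum_eq_sum_range fun i hi => by
      rw [htrunc i hi, map_zero, Pi.zero_apply, LinearMap.zero_apply, smul_zero] ]
  simp only [map_sum, map_smul, LinearMap.sum_apply, LinearMap.smul_apply, add_comm _ l, hmode]

theorem zeroMode_circ (hg : A.IsAutomorphism g) (hfin : IsOfFinOrder g) (hr : r < orderOf g)
    (hu : u ∈ A.gradedPiece g n r) (v : V) (hw : w ∈ W.Omega) :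
    W.zeroMode (A.circ g n r u v) w = 0 := by
  rw [circ_eq_binRes]
  induction v using homogeneous_induction hg hfin with
  | zero => simp
  | add v v' hv hv' => simp only [map_add, LinearMap.add_apply, hv, hv', add_zero]
  | mem m s v hs hv =>
    by_cases hrs : (r + s) % orderOf g = 0
    · have hT : (0 : ℚ) < orderOf g := Nat.cast_pos.2 hfin.orderOf_pos
      have hlt : (r : ℚ) / (orderOf g : ℚ) < 1 := (div_lt_one hT).2 (Nat.cast_lt.2 hr)
      have hpos : 0 < (r : ℚ) / (orderOf g : ℚ) + delta r := by
        rcases Nat.eq_zero_or_pos r with rfl | hr0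
        · simp [delta]
        · have : (0 : ℚ) < r := Nat.cast_pos.2 hr0
          simp only [delta, hr0.ne', if_false, Int.cast_zero, add_zero]
          positivity
      have hzero (i : ℕ) : W.mode v (m - (r : ℚ) / (orderOf g : ℚ) + i) w = 0 := by
        refine mode_eq_zero_of_mem_Omega hw hs hv ?_
        have : (0 : ℚ) ≤ i := Nat.cast_nonneg i
        linarith
      rw [W.zeroMode_binRes hg hfin hr hu hv hrs hw
        (p := (n : ℚ) - 1 + (r : ℚ) / (orderOf g : ℚ) + delta r)
        (q := m - (r : ℚ) / (orderOf g : ℚ)) (n - 1 + delta r) (-1 - delta r) (by push_cast; rfl)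
        (by push_cast; ring) (by linarith) (by push_cast; ring)]
      exact finsum_eq_zero_of_forall_eq_zero fun i => by rw [hzero i, map_zero, smul_zero]
    · have huv : A.binRes ((n : ℂ) - 1 + (r : ℂ) / (orderOf g : ℂ) + delta r) (-1 - delta r) u v ∈
          gEigen g ((r + s) % orderOf g) := by
        rw [gEigen_mod hfin]
        exact A.binRes_mem fun i => (mode_mem_gradedPiece hg hu hv _).2
      rw [W.zeroMode_of_mem_gEigen hrs (Nat.mod_lt _ hfin.orderOf_pos) huv, LinearMap.zero_apply]

theorem zeroMode_of_mem_Og (hg : A.IsAutomorphism g) (hfin : IsOfFinOrder g) (hu : u ∈ A.Og g)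
    (hw : w ∈ W.Omega) : W.zeroMode u w = 0 := by
  induction hu using Submodule.span_induction with
  | zero => simp
  | add x y _ _ hx hy => simp [hx, hy]
  | smul c x _ hx => simp [hx]
  | mem x hx =>
    obtain ⟨n, r, u, v, hr, hn, hu, rfl⟩ := hx
    exact W.zeroMode_circ hg hfin hr ⟨hn, hu⟩ v hw

theorem zeroMode_starLeft (hg : A.IsAutomorphism g) (hfin : IsOfFinOrder g) (u v : V)
    (hw : w ∈ W.Omega) : W.zeroMode (A.starLeft g u v) w = W.zeroMode u (W.zeroMode v w) := by
  induction u using invariant_induction hg hfin with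
  | zero => simp
  | add u u' hu hu' => simp [hu, hu']
  | twisted n r u hr0 hr hu =>
    rw [starLeft, invariantLift_of_mem_gEigen _ hr0 hr hu.2, W.zeroMode_of_mem_gEigen hr0 hr hu.2]
    simp
  | invariant n u hu =>
    induction v using invariant_induction hg hfin with
    | zero => simp
    | add v v' hv hv' => simp [hv, hv']
    | twisted m s v hs0 hs hv =>
      rw [W.zeroMode_of_mem_Og hg hfin (starLeft_mem_compatibleMaps hg hfin u
        (mem_Og_of_mem_gradedPiece hg hs0 hs hv)) hw, W.zeroMode_of_mem_gEigen hs0 hs hv.2]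
      simp
    | invariant m v hv =>
      have hzero (i : ℕ) (hi : i ≠ 0) : W.mode v ((m - 1 : ℤ) + i) w = 0 := by
        refine mode_eq_zero_of_mem_Omega hw hfin.orderOf_pos hv ?_
        have : (1 : ℚ) ≤ i := Nat.one_le_cast.2 (Nat.pos_of_ne_zero hi)
        push_cast
        linarith
      rw [starLeft, invariantLift_of_mem _ hfin hu, W.zeroMode_of_mem hfin hu,
        W.zeroMode_of_mem hfin hv, W.zeroMode_binRes hg hfin hfin.orderOf_pos hu hv
          (Nat.zero_mod _) hw (p := n) (q := (m - 1 : ℤ)) n (-1) (by simp) (by simp) (by linarith)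
          (by push_cast; ring),
        finsum_eq_single _ 0 fun i hi => by rw [hzero i hi, map_zero, smul_zero] ]
      simp [sub_eq_add_neg]

/-- The action of `V` on `Ω(M)` by zero modes. -/
def zeroModeOmega (hg : A.IsAutomorphism g) (hfin : IsOfFinOrder g) :
    V →ₗ[ℂ] Module.End ℂ W.Omega where
  toFun u := (W.zeroMode u).restrict fun _ hw => W.zeroMode_mem_Omega hg hfin u hw
  map_add' u v := by
    ext w
    simp
  map_smul' c u := by
    ext w
    simp

/-- The representation of `A_g(V)` on `Ω(M)`. -/
def agRep (hg : A.IsAutomorphism g) (hfin : IsOfFinOrder g) :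
    A.Ag g →ₗ[ℂ] Module.End ℂ W.Omega :=
  (A.Og g).liftQ (W.zeroModeOmega hg hfin) fun u hu => by
    ext w
    exact W.zeroMode_of_mem_Og hg hfin hu w.2

theorem coe_agRep_mkQ (hg : A.IsAutomorphism g) (hfin : IsOfFinOrder g) (u : V) (w : W.Omega) :
    (W.agRep hg hfin ((A.Og g).mkQ u) w : M) = W.zeroMode u w := rfl

theorem agRep_vac (hg : A.IsAutomorphism g) (hfin : IsOfFinOrder g) :
    W.agRep hg hfin ((A.Og g).mkQ A.vac) = 1 := by
  ext w
  rw [coe_agRep_mkQ, W.zeroMode_of_mem hfin (vac_mem_gradedPiece hg), W.vac_mode,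
    if_pos (by norm_num)]
  rfl

theorem agRep_agMul (hg : A.IsAutomorphism g) (hfin : IsOfFinOrder g) (x y : A.Ag g) :
    W.agRep hg hfin (agMul hg hfin x y) = W.agRep hg hfin x * W.agRep hg hfin y := by
  obtain ⟨u, rfl⟩ := (A.Og g).mkQ_surjective x
  obtain ⟨v, rfl⟩ := (A.Og g).mkQ_surjective y
  ext w
  exact W.zeroMode_starLeft hg hfin u v w.2

theorem coe_agRep_mkQ_eq_action_o (hg : A.IsAutomorphism g) (hfin : IsOfFinOrder g) {a : V}
    (hn : a ∈ A.weightSpace n) (ha : a ∈ gEigen g 0) (w : W.Omega) :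
    (W.agRep hg hfin ((A.Og g).mkQ a) w : M) = W.action (A.o hfin n a ha) w := by
  rw [coe_agRep_mkQ, W.zeroMode_of_mem hfin ⟨hn, ha⟩, o, action_mk]

end WeakTwistedModule

end

open VertexOperatorAlgebra WeakTwistedModule in
theorem theorem5p3 {V : Type*} [AddCommGroup V] [Module ℂ V] (A : VertexOperatorAlgebra V)
    (g : V ≃ₗ[ℂ] V) (hg : A.IsAutomorphism g) (hfin : IsOfFinOrder g)
    {M : Type*} [AddCommGroup M] [Module ℂ M] (W : WeakTwistedModule A g M) :
    -- the associative unital product induced on the quotient by the product on `V`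
    ∃ mul : A.Ag g →ₗ[ℂ] A.Ag g →ₗ[ℂ] A.Ag g,
      (∀ u v : V, mul ((A.Og g).mkQ u) ((A.Og g).mkQ v) = (A.Og g).mkQ (A.starProduct g u v)) ∧
      (∀ x y z : A.Ag g, mul (mul x y) z = mul x (mul y z)) ∧
      (∀ x : A.Ag g, mul ((A.Og g).mkQ A.vac) x = x ∧ mul x ((A.Og g).mkQ A.vac) = x) ∧
      -- the representation
      ∃ ρ : A.Ag g →ₗ[ℂ] Module.End ℂ W.Omega,
        ρ ((A.Og g).mkQ A.vac) = 1 ∧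
        (∀ x y : A.Ag g, ρ (mul x y) = ρ x * ρ y) ∧
        ∀ (n : ℤ) (a : V) (ha : a ∈ gEigen g 0), a ∈ A.weightSpace n →
          ∀ w : W.Omega, (ρ ((A.Og g).mkQ a) w : M) = W.action (A.o hfin n a ha) w := by
  refine ⟨agMul hg hfin, fun u v => ?_, agMul_assoc hg hfin,
    fun x => ⟨agMul_vac_left hg hfin x, agMul_vac_right hg hfin x⟩, W.agRep hg hfin,
    W.agRep_vac hg hfin, W.agRep_agMul hg hfin,
    fun n a ha hn w => W.coe_agRep_mkQ_eq_action_o hg hfin hn ha w⟩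
  rw [agMul_mkQ, starProduct_eq_starLeft]
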